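/- All graphs are finite, simple and undirected. For a vertex-coloured graph, call two vertices $a,b$ rainbow vertex-connected if some $a$–$b$ path has internal vertices of pairwise distinct colours. Let $rvc(G)$ be the least number of colours in a vertex-colouring of $G$ for which every two vertices are rainbow vertex-connected (with $rvc(G)=0$ if $G$ is complete and $rvc(G)=\infty$ if $G$ is disconnected). For each fixed integer $k\ge 2$ the following two decision problems are polynomial-time equivalent, that is, each has a polynomial-time many-one reduction to the other: 1. Given a graph $G$, decide whether $rvc(G)\le k$. 2. ($k$-subset rainbow vertex-connection) Given a graph $G$ and a set $P\subseteq V(G)\times V(G)$, decide whether there is a vertex-colouring of $G$ with $k$ colours for which every pair $(a,b)\in P$ is rainbow vertex-connected. Moreover, a polynomial-time reduction from Problem 2 to Problem 1 is given by $(G,P)\mapsto G_k$ (up to isomorphism), where $G_k$, defined below, is connected whenever $G$ has a vertex and contains $G$ as the induced subgraph on its top layer. Construction of $G_k$. Let $V=V(G)$ and let $N$ be the set of $(i,j)\in V\times V$ with $(i,j)\notin P$ and $(j,i)\notin P$. Throughout $\alpha,\beta\in\{1,2\}$, and the top layer of $G_k$ is $\{v_{i,k}:i\in V\}$, with $v_{i,k}v_{j,k}$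 an edge iff $ij\in E(G)$. - $G_2$ has, besides its top layer, the vertices $u$, $v_{i,0}^{(\alpha)}$ ($i\in V$), $w_{p}^{(\alpha)}$ ($p\in N$). Its edges outside the top layer join $u$ to all $v_{i,0}^{(\alpha)}$ and all $w_p^{(\alpha)}$; $v_{i,0}^{(1)}$ to $v_{i,0}^{(2)}$; $w_p^{(1)}$ to $w_p^{(2)}$; $v_{i,2}$ to $v_{i,0}^{(\alpha)}$; and, for $p=(i,j)\in N$, $v_{i,2}$ to $w_p^{(1)}$ and $v_{j,2}$ to $w_p^{(2)}$. - $G_3$ has, besides its top layer, the vertices $v_{i,0}^{(\alpha)}, v_{i,1}^{(\alpha)}$ ($i\in V$), $u_p^{(\alpha)}, w_p^{(\alpha)}$ ($p\in N$). Its edges outside the top layer make the set of all $v_{i,0}^{(\alpha)}$ and $u_p^{(\alpha)}$ a clique and join $v_{i,0}^{(\alpha)}$ to $v_{i,1}^{(\beta)}$; $u_p^{(\alpha)}$ to $w_p^{(\beta)}$; $v_{i,1}^{(1)}$ to $v_{i,1}^{(2)}$; $v_{i,3}$ to $v_{i,1}^{(\alpha)}$; and, for $p=(i,j)\in N$, $v_{i,3}$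 to $w_p^{(1)}$ and $v_{j,3}$ to $w_p^{(2)}$. - For $k\ge 4$, $G_k$ arises from $G_{k-2}$ by deleting the edges within its top layer, replacing each top vertex $v_{i,k-2}$ by two adjacent vertices $v_{i,k-2}^{(1)},v_{i,k-2}^{(2)}$, each joined to all the neighbours that $v_{i,k-2}$ had below the top layer, and adding the new top layer $\{v_{i,k}\}$ with its edges, where $v_{i,k}$ is also joined to $v_{i,k-2}^{(1)}$ and $v_{i,k-2}^{(2)}$. -/

import Mathlib

open Turing

namespace RVC

/-! ### Rainbow vertex-connection -/

/-- Under the vertex-colouring `c`, some `a`-`b` path has pairwise distinctly coloured internal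
vertices. The internal vertices are the vertices of the path other than its first and last one. -/
def RainbowPair {V C : Type} (G : SimpleGraph V) (c : V → C) (a b : V) : Prop :=
  ∃ p : G.Walk a b, p.IsPath ∧ (p.support.tail.dropLast.map c).Nodup

/-- The vertex-colouring `c` makes `G` rainbow vertex-connected. -/
def RainbowConnected {V C : Type} (G : SimpleGraph V) (c : V → C) : Prop :=
  ∀ a b : V, RainbowPair G c a b

open Classical in
/-- The rainbow vertex-connection number: the least number of colours that make `G` rainbow
vertex-connected. It is `0` for complete graphs, whose paths of length one have no internal
vertices to be coloured, and `⊤` for disconnected graphs. -/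
noncomputable def rvc {V : Type} (G : SimpleGraph V) : ℕ∞ :=
  if G = ⊤ then 0
  else ⨅ (m : ℕ) (_ : ∃ c : V → Fin m, RainbowConnected G c), (m : ℕ∞)

/-! ### The two decision problems and their instances -/

/-- A finite simple graph. -/
structure GraphInstance where
  /-- the number of vertices -/
  order : ℕ
  /-- the graph -/
  graph : SimpleGraph (Fin order)

/-- A finite simple graph with a set of pairs of its vertices. -/
structure PairInstance where
  /-- the number of vertices -/
  order : ℕ
  /-- the graph -/
  graph : SimpleGraph (Fin order)
  /-- the set of pairs -/
  pairs : Set (Fin order × Fin order)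

/-- The problem of deciding whether `rvc G ≤ k`. -/
def RvcAtMost (k : ℕ) (x : GraphInstance) : Prop :=
  rvc x.graph ≤ (k : ℕ∞)

/-- The `k`-subset rainbow vertex-connection problem. -/
def SubsetRainbow (k : ℕ) (x : PairInstance) : Prop :=
  ∃ c : Fin x.order → Fin k, ∀ q ∈ x.pairs, RainbowPair x.graph c q.1 q.2

/-! ### Encoding of the instances as bit strings -/

open Classical in
/-- The `n × n` zero-one matrix of a binary relation, row by row. -/
noncomputable def relBits {n : ℕ} (r : Fin n → Fin n → Prop) : List Bool :=
  (List.finRange n).flatMap fun i => (List.finRange n).map fun j => decide (r i j)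

/-- The number of vertices in unary, closed by a zero, followed by the adjacency matrix. -/
noncomputable def encodeGraph (x : GraphInstance) : List Bool :=
  List.replicate x.order true ++ false :: relBits x.graph.Adj

/-- The number of vertices in unary, closed by a zero, followed by the adjacency matrix and by the
matrix of the set of pairs. -/
noncomputable def encodePairs (x : PairInstance) : List Bool :=
  List.replicate x.order true ++
    false :: (relBits x.graph.Adj ++ relBits fun i j => (i, j) ∈ x.pairs)

theorem relBits_length {n : ℕ} (r : Fin n → Fin n → Prop) : (relBits r).length = n * n := by
  simp [relBits, List.length_flatMap]

theorem relBits_injective {n : ℕ} {r s : Fin n → Fin n → Prop} (h : relBits r = relBits s) :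
    r = s := by
  classical
  have key : ∀ l : List (Fin n),
      (l.flatMap fun i => (List.finRange n).map fun j => decide (r i j)) =
        (l.flatMap fun i => (List.finRange n).map fun j => decide (s i j)) →
      ∀ i ∈ l, ∀ j, r i j ↔ s i j := by
    intro l
    induction l with
    | nil => simp
    | cons a l ih =>
      intro hl
      rw [List.flatMap_cons, List.flatMap_cons] at hl
      obtain ⟨h1, h2⟩ := List.append_inj hl (by simp)
      intro i hi j
      rcases List.mem_cons.1 hi with rfl | hi
      · simpa using List.map_inj_left.1 h1 j (List.mem_finRange j)
      · exact ih h2 i hi j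
  funext i j
  refine propext (key (List.finRange n) ?_ i (List.mem_finRange i) j)
  unfold relBits at h
  convert h

theorem unary_injective {m n : ℕ} {k l : List Bool}
    (h : List.replicate m true ++ false :: k = List.replicate n true ++ false :: l) :
    m = n ∧ k = l := by
  induction m generalizing n with
  | zero => cases n <;> simp_all [List.replicate_succ]
  | succ m ih =>
    cases n with
    | zero => simp [List.replicate_succ] at h
    | succ n =>
      simp only [List.replicate_succ, List.cons_append, List.cons.injEq, true_and] at h
      obtain ⟨h1, h2⟩ := ih h
      exact ⟨by rw [h1], h2⟩

/-- An instance can be recovered from its encoding. -/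
theorem encodeGraph_injective : Function.Injective encodeGraph := by
  rintro ⟨m, G⟩ ⟨n, H⟩ h
  obtain ⟨h1, h2⟩ := unary_injective h
  dsimp only at h1
  subst h1
  have := relBits_injective h2
  congr 1
  exact SimpleGraph.ext this

/-- An instance can be recovered from its encoding. -/
theorem encodePairs_injective : Function.Injective encodePairs := by
  rintro ⟨m, G, P⟩ ⟨n, H, Q⟩ h
  obtain ⟨h1, h2⟩ := unary_injective h
  dsimp only at h1
  subst h1
  obtain ⟨h3, h4⟩ := List.append_inj h2 (by simp [relBits_length])
  have h5 := relBits_injective h3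
  have h6 := relBits_injective h4
  congr 1
  · exact SimpleGraph.ext h5
  · ext ⟨i, j⟩
    exact iff_of_eq (congrFun (congrFun h6 i) j)

/-! ### Polynomial-time reductions -/

/-- The function `f` is computable in polynomial time by a Turing machine, with respect to the
encodings `ea` and `eb` of its arguments and values. -/
def PolyTimeComputable {α β : Type} (ea : α → List Bool) (eb : β → List Bool) (f : α → β) : Prop :=
  Nonempty (TM2ComputableInPolyTime ea eb f)

/-- `f` is a polynomial-time many-one reduction of the decision problem `A` to `B`. -/
def IsPolyTimeReduction {α β : Type} (ea : α → List Bool) (eb : β → List Bool)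
    (A : α → Prop) (B : β → Prop) (f : α → β) : Prop :=
  PolyTimeComputable ea eb f ∧ ∀ x, A x ↔ B (f x)

/-- The decision problems `A` and `B` are polynomial-time equivalent: each of them has a
polynomial-time many-one reduction to the other. -/
def PolyTimeEquivalent {α β : Type} (ea : α → List Bool) (eb : β → List Bool)
    (A : α → Prop) (B : β → Prop) : Prop :=
  (∃ f, IsPolyTimeReduction ea eb A B f) ∧ ∃ g, IsPolyTimeReduction eb ea B A g

/-! ### The graphs `G_k` -/

section Construction

variable {V : Type}

/-- The pairs `(i, j)` of `V × V` outside `P`, where the pairs in `P` are read as unordered. -/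
def NonPair (P : Set (V × V)) : Type :=
  {q : V × V // q ∉ P ∧ q.swap ∉ P}

/-- The part of `G_k` below its top layer, together with the edges that join it to the top layer.
The top layer has one vertex for each vertex of `G`. -/
structure Lower (V : Type) where
  /-- the vertices below the top layer -/
  carrier : Type
  /-- the graph that they induce -/
  graph : SimpleGraph carrier
  /-- `att i x`: the top vertex belonging to `i` is adjacent to `x` -/
  att : V → carrier → Prop

/-- The vertices of `G_2` below the top layer. The superscripts `(1)` and `(2)` are `false` and
`true`. -/
inductive EvenVertex (P : Set (V × V)) : Type
  | u : EvenVertex P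
  | v : V → Bool → EvenVertex P
  | w : NonPair P → Bool → EvenVertex P

/-- The edges of `G_2` below the top layer, listed up to symmetry. -/
def evenRel (P : Set (V × V)) : EvenVertex P → EvenVertex P → Prop
  | .u, _ => True
  | .v i _, .v j _ => i = j
  | .w p _, .w q _ => p = q
  | _, _ => False

/-- The edges of `G_2` between the top layer and the rest. -/
def evenAtt (P : Set (V × V)) (i : V) : EvenVertex P → Prop
  | .u => False
  | .v j _ => i = j
  | .w p false => i = p.1.1
  | .w p true => i = p.1.2

/-- The vertices of `G_3` below the top layer: layer `0` consists of the vertices `v0` and `u`, and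
layer `1` of the vertices `v1` and `w`. -/
inductive OddVertex (P : Set (V × V)) : Type
  | v0 : V → Bool → OddVertex P
  | u : NonPair P → Bool → OddVertex P
  | v1 : V → Bool → OddVertex P
  | w : NonPair P → Bool → OddVertex P

/-- The edges of `G_3` below the top layer, listed up to symmetry. -/
def oddRel (P : Set (V × V)) : OddVertex P → OddVertex P → Prop
  | .v0 _ _, .v0 _ _ => True
  | .v0 _ _, .u _ _ => True
  | .u _ _, .u _ _ => True
  | .v0 i _, .v1 j _ => i = j
  | .u p _, .w q _ => p = q
  | .v1 i _, .v1 j _ => i = j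
  | _, _ => False

/-- The edges of `G_3` between the top layer and the rest. -/
def oddAtt (P : Set (V × V)) (i : V) : OddVertex P → Prop
  | .v0 _ _ => False
  | .u _ _ => False
  | .v1 j _ => i = j
  | .w p false => i = p.1.1
  | .w p true => i = p.1.2

/-- The inductive step: each top vertex is split into two adjacent vertices, which inherit its
neighbours below the top layer; the edges within the old top layer are dropped; and a new top layer
is added, each vertex of which is joined to the two vertices into which its predecessor was split. -/
def Lower.split (X : Lower V) : Lower V where
  carrier := X.carrier ⊕ (V × Bool)
  graph := SimpleGraph.fromRel fun a b =>
    match a, b with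
    | .inl x, .inl y => X.graph.Adj x y
    | .inl x, .inr (i, _) => X.att i x
    | .inr (i, _), .inr (j, _) => i = j
    | _, _ => False
  att i a :=
    match a with
    | .inl _ => False
    | .inr (j, _) => i = j

/-- The part of `G_k` below its top layer, by recursion from `k` to `k + 2`, starting from `k = 2`
and `k = 3`. (The values at `k = 0` and `k = 1` have no meaning.) -/
def lower (P : Set (V × V)) : ℕ → Lower V
  | 0 | 1 | 2 => ⟨EvenVertex P, SimpleGraph.fromRel (evenRel P), evenAtt P⟩
  | 3 => ⟨OddVertex P, SimpleGraph.fromRel (oddRel P), oddAtt P⟩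
  | k + 4 => (lower P (k + 2)).split

/-- The graph `G_k`, for `k ≥ 2`. Its top layer, on which it induces a copy of `G`, consists of the
vertices `Sum.inr i`. -/
def layeredGraph (G : SimpleGraph V) (P : Set (V × V)) (k : ℕ) :
    SimpleGraph ((lower P k).carrier ⊕ V) :=
  SimpleGraph.fromRel fun a b =>
    match a, b with
    | .inl x, .inl y => (lower P k).graph.Adj x y
    | .inl x, .inr i => (lower P k).att i x
    | .inr i, .inr j => G.Adj i j
    | _, _ => False

end Construction

end RVC

/-! Taking `P` to be the set of all pairs reduces Problem 1 to Problem 2, since for `k > 0` the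
condition `rvc G ≤ k` means that some colouring by `Fin k` connects all pairs (`rvc_le_iff`). The
other reduction has a combinatorial half, `exists_rainbowConnected_layeredGraph_iff`, and a
computational half, `exists_polyTimeComputable_layeredGraph`.

A good colouring of `G` extends to `G_k` as follows. Pairs of top vertices in `P` keep their paths
in `G`. A pair that is in `P` in neither order is joined through its gadget `w` by a path with `k`
internal vertices, one of each colour. All pairs that involve a lower vertex are joined by paths
that descend towards the bottom layers. The colouring is built by induction from `k` to `k + 2`
(`LowerColouring.split`): the two copies of a split vertex receive the two new colours, one for
leaving upwards at each end. The bottom uses a colour `s` that remains a parameter. During the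
induction it lies outside the range of the other colours, and only in the end is it identified with
the last of the `k` colours.

Conversely, a rainbow path in `k` colours has at most `k` internal vertices, hence length at most `k
+ 1`. A function that is 1-Lipschitz on the lower part (`Potential`, again extended from `k` to `k +
2`) shows that an excursion from the top vertex `a` through lower layers to another top vertex `b`
has length at least `k + 1`, and at least `k + 2` if `(a, b)` or `(b, a)` is in `P`. So a rainbow
path between the ends of a pair in `P` never leaves the top layer, and is a path of `G`.

For the running time, structured stack programs are compiled to `TM2` machines with the same step
count (`Exec.iterate_step`), and programs with loops bounded by the order `n` are compiled to stack
programs with polynomial time bounds (`Runs.cmd`). Each vertex of `G_k` has a name consisting of one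
of finitely many tags and at most two numbers below `n`, and adjacency is a Boolean combination of
equalities of these numbers and lookups in the input matrices. For fixed `k`, one program with
nested loops therefore writes the encoding of a graph isomorphic to `G_k` (`Naming.exists_equiv`).
-/

/-! ### Structured programs on stacks of bits -/

namespace StackProgram

/-- The internal memory of a program: the result of the last `pop`, and a flag. -/
abbrev Memory : Type := Option Bool × Bool

/-- Structured programs that operate on a family of stacks of bits. -/
inductive Prog (K : Type) : Type
  | push : K → (Memory → Bool) → Prog K
  | pop : K → (Memory → Option Bool → Memory) → Prog K
  | peek : K → (Memory → Option Bool → Memory) → Prog K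
  | load : (Memory → Memory) → Prog K
  | seq : Prog K → Prog K → Prog K
  | ite : (Memory → Bool) → Prog K → Prog K → Prog K
  | loop : (Memory → Bool) → Prog K → Prog K

variable {K : Type}

namespace Prog

/-- The positions in a program. -/
def Label : Prog K → Type
  | push _ _ => Unit
  | pop _ _ => Unit
  | peek _ _ => Unit
  | load _ => Unit
  | seq p q => p.Label ⊕ q.Label
  | ite _ p q => Option (p.Label ⊕ q.Label)
  | loop _ p => Option p.Label

noncomputable instance labelFintype : (p : Prog K) → Fintype p.Label
  | push _ _ => inferInstanceAs (Fintype Unit)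
  | pop _ _ => inferInstanceAs (Fintype Unit)
  | peek _ _ => inferInstanceAs (Fintype Unit)
  | load _ => inferInstanceAs (Fintype Unit)
  | seq p q =>
    letI := labelFintype p
    letI := labelFintype q
    inferInstanceAs (Fintype (p.Label ⊕ q.Label))
  | ite _ p q =>
    letI := labelFintype p
    letI := labelFintype q
    inferInstanceAs (Fintype (Option (p.Label ⊕ q.Label)))
  | loop _ p =>
    letI := labelFintype p
    inferInstanceAs (Fintype (Option p.Label))

/-- The position where the execution of a program starts. -/
def entry : (p : Prog K) → p.Label
  | push _ _ => ()
  | pop _ _ => ()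
  | peek _ _ => ()
  | load _ => ()
  | seq p _ => Sum.inl p.entry
  | ite _ _ _ => (none : Option _)
  | loop _ _ => (none : Option _)

/-- The statements of the machine that executes a program, where `emb` embeds the positions of
the program into the labels of the machine and `exit` is executed in the end. -/
def code {Λ : Type} : (p : Prog K) → (p.Label → Λ) →
    TM2.Stmt (fun _ : K => Bool) Λ Memory → p.Label → TM2.Stmt (fun _ : K => Bool) Λ Memory
  | push k f, _, exit, _ => .push k f exit
  | pop k f, _, exit, _ => .pop k f exit
  | peek k f, _, exit, _ => .peek k f exit
  | load f, _, exit, _ => .load f exit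
  | seq p q, emb, exit, l =>
    match l with
    | Sum.inl l => p.code (fun x => emb (Sum.inl x)) (.goto fun _ => emb (Sum.inr q.entry)) l
    | Sum.inr l => q.code (fun x => emb (Sum.inr x)) exit l
  | ite b p q, emb, exit, l =>
    match l with
    | none => .branch b (.goto fun _ => emb (some (Sum.inl p.entry)))
        (.goto fun _ => emb (some (Sum.inr q.entry)))
    | some (Sum.inl l) => p.code (fun x => emb (some (Sum.inl x))) exit l
    | some (Sum.inr l) => q.code (fun x => emb (some (Sum.inr x))) exit l
  | loop b p, emb, exit, l =>
    match l with
    | none => .branch b (.goto fun _ => emb (some p.entry)) exit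
    | some l => p.code (fun x => emb (some x)) (.goto fun _ => emb none) l

end Prog

/-! ### Execution of structured programs and their simulation by `TM2` machines -/

variable [DecidableEq K]

/-- The execution of a program, with the number of steps that it takes. -/
inductive Exec : Prog K → Memory × (K → List Bool) → Memory × (K → List Bool) → ℕ → Prop
  | push (k f v S) : Exec (.push k f) (v, S) (v, Function.update S k (f v :: S k)) 1
  | pop (k f v S) :
    Exec (.pop k f) (v, S) (f v (S k).head?, Function.update S k (S k).tail) 1
  | peek (k f v S) : Exec (.peek k f) (v, S) (f v (S k).head?, S) 1
  | load (f v S) : Exec (.load f) (v, S) (f v, S) 1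
  | seq {p q s₁ s₂ s₃ t₁ t₂} : Exec p s₁ s₂ t₁ → Exec q s₂ s₃ t₂ →
    Exec (.seq p q) s₁ s₃ (t₂ + t₁)
  | ite_true {b p q s₁ s₂ t} : b s₁.1 = true → Exec p s₁ s₂ t → Exec (.ite b p q) s₁ s₂ (t + 1)
  | ite_false {b p q s₁ s₂ t} : b s₁.1 = false → Exec q s₁ s₂ t → Exec (.ite b p q) s₁ s₂ (t + 1)
  | loop_false {b p s} : b s.1 = false → Exec (.loop b p) s s 1
  | loop_true {b p s₁ s₂ s₃ t₁ t₂} : b s₁.1 = true → Exec p s₁ s₂ t₁ → Exec (.loop b p) s₂ s₃ t₂ →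
    Exec (.loop b p) s₁ s₃ (t₂ + (t₁ + 1))

/-- Quantifying over `emb` and `exit` makes the induction work: a subprogram sits inside a larger
machine and continues with code of its context. That continuation is run within the last step of the
program, so sequencing costs no step of its own. -/
theorem Exec.iterate_step {Λ : Type} (M : Λ → TM2.Stmt (fun _ : K => Bool) Λ Memory) {p : Prog K}
    {s s' : Memory × (K → List Bool)} {t : ℕ} (h : Exec p s s' t) :
    ∀ (emb : p.Label → Λ) (exit : TM2.Stmt (fun _ : K => Bool) Λ Memory),
      (∀ l, M (emb l) = p.code emb exit l) →
      (flip bind (TM2.step M))^[t] (some ⟨some (emb p.entry), s.1, s.2⟩) =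
        some (TM2.stepAux exit s'.1 s'.2) := by
  induction h with
  | push k f v S =>
    intro emb exit hM
    have := hM ()
    simp [flip, TM2.step, Prog.entry, this, Prog.code]
  | pop k f v S =>
    intro emb exit hM
    have := hM ()
    simp [flip, TM2.step, Prog.entry, this, Prog.code]
  | peek k f v S =>
    intro emb exit hM
    have := hM ()
    simp [flip, TM2.step, Prog.entry, this, Prog.code]
  | load f v S =>
    intro emb exit hM
    have := hM ()
    simp [flip, TM2.step, Prog.entry, this, Prog.code]
  | seq _ _ ih₁ ih₂ =>
    intro emb exit hM
    -- The step count is `t₂ + t₁` in this order because an iterate of a sum applies the second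
    -- summand first.
    rw [Function.iterate_add_apply]
    have h₁ := ih₁ (fun x => emb (Sum.inl x)) _ fun l => hM (Sum.inl l)
    have h₂ := ih₂ (fun x => emb (Sum.inr x)) _ fun l => hM (Sum.inr l)
    simp only [Prog.entry]
    rw [h₁]
    exact h₂
  | ite_true hb _ ih =>
    intro emb exit hM
    have h₁ := ih (fun x => emb (some (Sum.inl x))) _ fun l => hM (some (Sum.inl l))
    have h₀ := hM none
    rw [Function.iterate_succ_apply, ← h₁]
    congr 1
    simp [flip, TM2.step, Prog.entry, h₀, Prog.code, hb]
  | ite_false hb _ ih =>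
    intro emb exit hM
    have h₁ := ih (fun x => emb (some (Sum.inr x))) _ fun l => hM (some (Sum.inr l))
    have h₀ := hM none
    rw [Function.iterate_succ_apply, ← h₁]
    congr 1
    simp [flip, TM2.step, Prog.entry, h₀, Prog.code, hb]
  | loop_false hb =>
    intro emb exit hM
    have h₀ := hM none
    simp [flip, TM2.step, Prog.entry, h₀, Prog.code, hb]
  | loop_true hb _ _ ih₁ ih₂ =>
    intro emb exit hM
    have h₁ := ih₁ (fun x => emb (some x)) _ fun l => hM (some l)
    have h₀ := hM none
    rw [Function.iterate_add_apply, Function.iterate_succ_apply, ← ih₂ emb exit hM]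
    congr 1
    refine Eq.trans ?_ h₁
    congr 1
    simp [flip, TM2.step, Prog.entry, h₀, Prog.code, hb]

/-- The machine that executes a program and halts. -/
noncomputable def machine [Fintype K] (p : Prog K) (k₀ k₁ : K) : FinTM2 where
  K := K
  k₀ := k₀
  k₁ := k₁
  Γ _ := Bool
  Λ := p.Label
  main := p.entry
  σ := Memory
  initialState := (none, false)
  Γk₀Fin := inferInstanceAs (Fintype Bool)
  m := p.code id .halt

/-- A function is computable in polynomial time if a program computes it in polynomial time. -/
theorem polyTimeComputable_of_exec [Fintype K] {α β : Type} {ea : α → List Bool}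
    {eb : β → List Bool} {f : α → β} (p : Prog K) (k₀ k₁ : K) (T : Polynomial ℕ)
    (h : ∀ a, ∃ t ≤ T.eval (ea a).length,
      Exec p ((none, false), Function.update (fun _ => []) k₀ (ea a))
        ((none, false), Function.update (fun _ => []) k₁ (eb (f a))) t) :
    RVC.PolyTimeComputable ea eb f := by
  refine ⟨{ tm := machine p k₀ k₁
            inputAlphabet := Equiv.refl _
            outputAlphabet := Equiv.refl _
            time := T
            outputsFun := fun a => ?_ }⟩
  choose t ht h using h
  have key : ∀ (k₀ k : K) (s : List Bool),
      (if _h : k = k₀ then s else []) = Function.update (fun _ => []) k₀ s k := by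
    intro k₀ k s
    by_cases hk : k = k₀ <;> simp [hk]
  have h₀ : initList (machine p k₀ k₁) (ea a) =
      ⟨some p.entry, (none, false), Function.update (fun _ => []) k₀ (ea a)⟩ :=
    congrArg (TM2.Cfg.mk _ _) (funext fun k => key k₀ k (ea a))
  -- A halting configuration must have the initial memory and empty stacks apart from the output,
  -- which is why `p` has to clean up after itself.
  have h₁ : haltList (machine p k₀ k₁) (eb (f a)) =
      ⟨none, (none, false), Function.update (fun _ => []) k₁ (eb (f a))⟩ :=
    congrArg (TM2.Cfg.mk _ _) (funext fun k => key k₁ k (eb (f a)))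
  refine ⟨⟨t a, ?_⟩, ht a⟩
  have h₂ := (h a).iterate_step (p.code id .halt) id .halt fun _ => rfl
  have e : ∀ s : List Bool, s.map (Equiv.refl Bool).invFun = s := List.map_id
  refine (congrArg _ (congrArg some ?_)).trans (h₂.trans (congrArg some ?_))
  · exact (congrArg _ (e _)).trans h₀
  · exact ((congrArg _ (e _)).trans h₁).symm

end StackProgram

namespace StackProgram

/-! ### Execution up to the contents of the register -/

section Runs

variable {K : Type} [DecidableEq K]

/-- Started with `r` in the register, the program leads from the flag and the stacks `s` to `s'` in
at most `T` steps. -/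
def RunsFrom (r : Option Bool) (p : Prog K) (s s' : Bool × (K → List Bool)) (T : ℕ) : Prop :=
  ∃ r', ∃ t ≤ T, Exec p ((r, s.1), s.2) ((r', s'.1), s'.2) t

/-- Whatever the register contains, the program leads from the flag and the stacks `s` to `s'` in
at most `T` steps. -/
def Runs (p : Prog K) (s s' : Bool × (K → List Bool)) (T : ℕ) : Prop :=
  ∀ r, RunsFrom r p s s' T

theorem RunsFrom.mono {r : Option Bool} {p : Prog K} {s s' : Bool × (K → List Bool)} {T T' : ℕ}
    (h : RunsFrom r p s s' T) (hT : T ≤ T') : RunsFrom r p s s' T' := by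
  obtain ⟨r', t, ht, h⟩ := h
  exact ⟨r', t, ht.trans hT, h⟩

theorem Runs.mono {p : Prog K} {s s' : Bool × (K → List Bool)} {T T' : ℕ}
    (h : Runs p s s' T) (hT : T ≤ T') : Runs p s s' T' := fun r => (h r).mono hT

theorem RunsFrom.seq {r : Option Bool} {p q : Prog K} {s₁ s₂ s₃ : Bool × (K → List Bool)}
    {T₁ T₂ : ℕ} (h₁ : RunsFrom r p s₁ s₂ T₁) (h₂ : Runs q s₂ s₃ T₂) :
    RunsFrom r (.seq p q) s₁ s₃ (T₁ + T₂) := by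
  obtain ⟨r₂, t₁, ht₁, h₁⟩ := h₁
  obtain ⟨r₃, t₂, ht₂, h₂⟩ := h₂ r₂
  exact ⟨r₃, t₂ + t₁, by omega, .seq h₁ h₂⟩

theorem Runs.seq {p q : Prog K} {s₁ s₂ s₃ : Bool × (K → List Bool)} {T₁ T₂ : ℕ}
    (h₁ : Runs p s₁ s₂ T₁) (h₂ : Runs q s₂ s₃ T₂) : Runs (.seq p q) s₁ s₃ (T₁ + T₂) :=
  fun r => (h₁ r).seq h₂

theorem Runs.push (k : K) (b f : Bool) (S : K → List Bool) :
    Runs (.push k fun _ => b) (f, S) (f, Function.update S k (b :: S k)) 1 :=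
  fun r => ⟨r, 1, le_rfl, .push ..⟩

/-- Push the contents of the register. -/
def pushReg (k : K) : Prog K := .push k fun v => v.1.getD false

theorem RunsFrom.pushReg (k : K) (b f : Bool) (S : K → List Bool) :
    RunsFrom (some b) (pushReg k) (f, S) (f, Function.update S k (b :: S k)) 1 :=
  ⟨some b, 1, le_rfl, .push ..⟩

theorem Runs.loadFlag (g : Bool → Bool) (f : Bool) (S : K → List Bool) :
    Runs (.load fun v => (v.1, g v.2)) (f, S) (g f, S) 1 :=
  fun r => ⟨r, 1, le_rfl, .load ..⟩

theorem Runs.popFlag (k : K) (g : Bool → Option Bool → Bool) (f : Bool) (S : K → List Bool) :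
    Runs (.pop k fun v o => (o, g v.2 o)) (f, S)
      (g f (S k).head?, Function.update S k (S k).tail) 1 :=
  fun _ => ⟨_, 1, le_rfl, .pop ..⟩

theorem Runs.peekFlag (k : K) (g : Bool → Option Bool → Bool) (f : Bool) (S : K → List Bool) :
    Runs (.peek k fun v o => (o, g v.2 o)) (f, S) (g f (S k).head?, S) 1 :=
  fun _ => ⟨_, 1, le_rfl, .peek ..⟩

theorem Runs.iteFlag {p q : Prog K} {f : Bool} {S : K → List Bool} {s' : Bool × (K → List Bool)}
    {T : ℕ} (h : Runs (if f then p else q) (f, S) s' T) :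
    Runs (.ite (fun v => v.2) p q) (f, S) s' (T + 1) := by
  intro r
  obtain ⟨r', t, ht, h⟩ := h r
  cases f with
  | true => exact ⟨r', t + 1, by omega, .ite_true rfl h⟩
  | false => exact ⟨r', t + 1, by omega, .ite_false rfl h⟩

/-- Pop the stack `k` until it is empty, and execute `p` after each `pop`. -/
def drain (k : K) (p : Prog K) : Prog K :=
  .seq (.pop k fun v o => (o, v.2))
    (.loop (fun v => v.1.isSome) (.seq p (.pop k fun v o => (o, v.2))))

theorem Runs.drain_nil {k : K} {p : Prog K} {s : Bool × (K → List Bool)} (h : s.2 k = []) :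
    Runs (drain k p) s s 2 := by
  intro r
  refine ⟨none, 1 + 1, le_rfl, .seq (.pop ..) ?_⟩
  have : Function.update s.2 k (s.2 k).tail = s.2 := by
    rw [h, List.tail_nil, ← h, Function.update_eq_self]
  rw [this, h]
  exact .loop_false rfl

/-- The body is run from a known register, since it may push the bit that has just been popped. -/
theorem Runs.drain_cons {k : K} {p : Prog K} {s₁ s₂ s₃ : Bool × (K → List Bool)} {b : Bool}
    {l : List Bool} {T₁ T₂ : ℕ} (h : s₁.2 k = b :: l)
    (h₁ : RunsFrom (some b) p (s₁.1, Function.update s₁.2 k l) s₂ T₁)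
    (h₂ : Runs (drain k p) s₂ s₃ T₂) : Runs (drain k p) s₁ s₃ (T₁ + 2 + T₂) := by
  intro r
  obtain ⟨r₂, t₁, ht₁, h₁⟩ := h₁
  obtain ⟨r₃, t₂, ht₂, h₂⟩ := h₂ r₂
  -- The run from `s₂` begins with a `pop` followed by the loop. This `pop` becomes the end of the
  -- first pass through the loop body, and the rest is the remaining loop.
  cases h₂ with
  | seq hp hl =>
    cases hp with
    | pop =>
      rename_i t
      refine ⟨r₃, (t + ((1 + t₁) + 1)) + 1, by omega, .seq (.pop ..) ?_⟩
      rw [h]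
      exact .loop_true rfl (.seq h₁ (.pop ..)) hl

/-- The sequence `s` plays the role of a loop invariant: `s i` is the state after `i` rounds, just
before the next `pop`. -/
theorem Runs.drain {k : K} {p : Prog K} {T : ℕ} : ∀ (l : List Bool)
    (s : ℕ → Bool × (K → List Bool)), (∀ i ≤ l.length, (s i).2 k = l.drop i) →
    (∀ (i : ℕ) (hi : i < l.length),
      RunsFrom (some l[i]) p ((s i).1, Function.update (s i).2 k (l.drop (i + 1))) (s (i + 1)) T) →
    Runs (drain k p) (s 0) (s l.length) (l.length * (T + 2) + 2)
  | [], s, h, _ => (Runs.drain_nil (h 0 le_rfl)).mono (by omega)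
  | b :: l, s, h, hb => by
    have ih := Runs.drain l (fun i => s (i + 1)) (fun i hi => by
      simpa using h (i + 1) (by simpa using hi)) fun i hi =>
        hb (i + 1) (Nat.succ_lt_succ hi)
    refine (Runs.drain_cons (h 0 (by simp)) (hb 0 (Nat.succ_pos _)) ih).mono ?_
    simp only [List.length_cons]
    ring_nf
    omega

/-- Empty a stack. -/
def clear (k : K) : Prog K := drain k (.load id)

theorem Runs.clear (k : K) (f : Bool) (S : K → List Bool) :
    Runs (clear k) (f, S) (f, Function.update S k []) ((S k).length * 3 + 2) := by
  have := Runs.drain (k := k) (p := .load id) (T := 1) (S k)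
    (fun i => (f, Function.update S k ((S k).drop i))) (fun i _ => by simp) fun i hi => by
      simp only [Function.update_idem]
      exact Runs.loadFlag id _ _ _
  simpa [StackProgram.clear] using this

/-- Pour a stack into another one. -/
def pour (k k' : K) : Prog K := drain k (pushReg k')

theorem Runs.pour {k k' : K} (hk : k ≠ k') (f : Bool) (S : K → List Bool) :
    Runs (pour k k') (f, S)
      (f, Function.update (Function.update S k []) k' ((S k).reverse ++ S k'))
      ((S k).length * 3 + 2) := by
  have := Runs.drain (k := k) (p := pushReg k') (T := 1) (S k)
    (fun i => (f, Function.update (Function.update S k ((S k).drop i)) k'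
      (((S k).take i).reverse ++ S k'))) (fun i _ => by simp [hk]) fun i hi => by
      refine cast (congrArg (RunsFrom _ _ _ · 1) ?_) (RunsFrom.pushReg k' (S k)[i] f _)
      simp only [Prod.mk.injEq, true_and]
      funext j
      by_cases h1 : j = k'
      · subst h1
        simp only [Function.update_self, Function.update_of_ne hk.symm]
        rw [List.take_succ_eq_append_getElem hi, List.reverse_append]
        rfl
      · by_cases h2 : j = k
        · subst h2
          simp [h1]
        · simp [h1, h2]
  simpa [StackProgram.pour] using this

end Runs

end StackProgram

namespace StackProgram

/-! ### A language of bounded loops over an input of bits -/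

/-- The variables. The last two are not used as loop variables but hold the bound of the loops. -/
abbrev Var : Type := Fin 6

/-- The stacks: the input, an auxiliary stack for the part of the input that was read, the reversed
output, the output, an auxiliary counter, and for each variable its value, an auxiliary stack for
the iteration over its value, and the number of iterations that its loop has left. -/
inductive Stk : Type
  | inp | aux | out | res | cnt
  | val (x : Var)
  | tmp (x : Var)
  | rem (x : Var)
  deriving DecidableEq, Fintype

/-- The stacks with the given contents. -/
def store (inp aux out res cnt : List Bool) (val tmp rem : Var → ℕ) : Stk → List Bool
  | .inp => inp
  | .aux => aux
  | .out => out
  | .res => res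
  | .cnt => cnt
  | .val x => List.replicate (val x) true
  | .tmp x => List.replicate (tmp x) true
  | .rem x => List.replicate (rem x) true

section store

variable (inp aux out res cnt l : List Bool) (val tmp rem : Var → ℕ)

@[simp] theorem store_inp : store inp aux out res cnt val tmp rem .inp = inp := rfl
@[simp] theorem store_aux : store inp aux out res cnt val tmp rem .aux = aux := rfl
@[simp] theorem store_out : store inp aux out res cnt val tmp rem .out = out := rfl
@[simp] theorem store_res : store inp aux out res cnt val tmp rem .res = res := rfl
@[simp] theorem store_cnt : store inp aux out res cnt val tmp rem .cnt = cnt := rfl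
@[simp] theorem store_val (x : Var) :
    store inp aux out res cnt val tmp rem (.val x) = List.replicate (val x) true := rfl
@[simp] theorem store_tmp (x : Var) :
    store inp aux out res cnt val tmp rem (.tmp x) = List.replicate (tmp x) true := rfl
@[simp] theorem store_rem (x : Var) :
    store inp aux out res cnt val tmp rem (.rem x) = List.replicate (rem x) true := rfl

@[simp] theorem update_store_inp :
    Function.update (store inp aux out res cnt val tmp rem) .inp l =
      store l aux out res cnt val tmp rem := by
  funext k; cases k <;> simp [Function.update]

@[simp] theorem update_store_aux :
    Function.update (store inp aux out res cnt val tmp rem) .aux l =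
      store inp l out res cnt val tmp rem := by
  funext k; cases k <;> simp [Function.update]

@[simp] theorem update_store_out :
    Function.update (store inp aux out res cnt val tmp rem) .out l =
      store inp aux l res cnt val tmp rem := by
  funext k; cases k <;> simp [Function.update]

@[simp] theorem update_store_res :
    Function.update (store inp aux out res cnt val tmp rem) .res l =
      store inp aux out l cnt val tmp rem := by
  funext k; cases k <;> simp [Function.update]

@[simp] theorem update_store_cnt :
    Function.update (store inp aux out res cnt val tmp rem) .cnt l =
      store inp aux out res l val tmp rem := by
  funext k; cases k <;> simp [Function.update]

@[simp] theorem update_store_val (x : Var) (m : ℕ) :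
    Function.update (store inp aux out res cnt val tmp rem) (.val x) (List.replicate m true) =
      store inp aux out res cnt (Function.update val x m) tmp rem := by
  funext k
  cases k with
  | val y => by_cases h : y = x <;> simp [h, Function.update]
  | _ => simp [Function.update]

@[simp] theorem update_store_tmp (x : Var) (m : ℕ) :
    Function.update (store inp aux out res cnt val tmp rem) (.tmp x) (List.replicate m true) =
      store inp aux out res cnt val (Function.update tmp x m) rem := by
  funext k
  cases k with
  | tmp y => by_cases h : y = x <;> simp [h, Function.update]
  | _ => simp [Function.update]

@[simp] theorem update_store_rem (x : Var) (m : ℕ) :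
    Function.update (store inp aux out res cnt val tmp rem) (.rem x) (List.replicate m true) =
      store inp aux out res cnt val tmp (Function.update rem x m) := by
  funext k
  cases k with
  | rem y => by_cases h : y = x <;> simp [h, Function.update]
  | _ => simp [Function.update]

end store

/-- The flag and the contents of the stacks that are not related to variables. -/
structure Scratch where
  /-- the flag -/
  flag : Bool
  /-- the part of the input that was not read -/
  inp : List Bool
  /-- the part of the input that was read -/
  aux : List Bool
  /-- the auxiliary counter -/
  cnt : List Bool

/-- The state with the given contents. -/
def state (d : Scratch) (out : List Bool) (val tmp rem : Var → ℕ) : Bool × (Stk → List Bool) :=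
  (d.flag, store d.inp d.aux out [] d.cnt val tmp rem)

/-- Repeat `p` as often as the value of `x` says. -/
def repeatVar (x : Var) (p : Prog Stk) : Prog Stk :=
  .seq (drain (.val x) (.seq p (.push (.tmp x) fun _ => true)))
    (drain (.tmp x) (.push (.val x) fun _ => true))

/-- A bound for the number of steps of `m` repetitions of a program that takes `T` steps. -/
def repeatTime {R : Type} [CommSemiring R] (m T : R) : R := m * (T + 6) + 4

theorem repeatTime_mono {m m' T T' : ℕ} (hm : m ≤ m') (hT : T ≤ T') :
    repeatTime m T ≤ repeatTime m' T' := by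
  unfold repeatTime
  gcongr

theorem eval_repeatTime (m T : Polynomial ℕ) (n : ℕ) :
    (repeatTime m T).eval n = repeatTime (m.eval n) (T.eval n) := by
  simp [repeatTime]

/-- The value of `x` is moved token by token to the stack `tmp x` and back. In between, `val x` and
`tmp x` are in flux, so the body must work for any contents of these two stacks; in particular,
nested repetitions need distinct variables. -/
theorem runs_repeatVar {x : Var} {p : Prog Stk} {T : ℕ} (d : ℕ → Scratch) {out : List Bool}
    {val tmp rem : Var → ℕ} (ht : tmp x = 0)
    (h : ∀ i < val x, ∀ val' tmp' : Var → ℕ, (∀ y ≠ x, val' y = val y) →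
      (∀ y ≠ x, tmp' y = tmp y) →
      Runs p (state (d i) out val' tmp' rem) (state (d (i + 1)) out val' tmp' rem) T) :
    Runs (repeatVar x p) (state (d 0) out val tmp rem) (state (d (val x)) out val tmp rem)
      (repeatTime (val x) T) := by
  have h₁ := Runs.drain (k := .val x) (p := .seq p (.push (.tmp x) fun _ => true)) (T := T + 1)
    (List.replicate (val x) true)
    (fun i => state (d i) out (Function.update val x (val x - i)) (Function.update tmp x i) rem)
    (fun i _ => by simp [state]) (fun i hi => by
      rw [List.length_replicate] at hi
      refine RunsFrom.seq (s₂ := state (d (i + 1)) out (Function.update val x (val x - (i + 1)))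
        (Function.update tmp x i) rem) ?_ ?_
      · refine cast (congrArg (RunsFrom _ _ · _ _) ?_) (h i hi
          (Function.update val x (val x - (i + 1))) (Function.update tmp x i)
          (fun y hy => by simp [hy]) (fun y hy => by simp [hy]) _)
        simp [state]
      · refine cast (congrArg (Runs _ _ · _) ?_) (Runs.push (Stk.tmp x) true _ _)
        simp [state, ← List.replicate_succ])
  have h₂ := Runs.drain (k := .tmp x) (p := .push (.val x) fun _ => true) (T := 1)
    (List.replicate (val x) true)
    (fun i => state (d (val x)) out (Function.update val x i)
      (Function.update tmp x (val x - i)) rem)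
    (fun i _ => by simp [state]) (fun i hi => by
      refine cast (congrArg₂ (RunsFrom _ _ · · 1) ?_ ?_) (Runs.push (Stk.val x) true (d (val x)).flag
        (store (d (val x)).inp (d (val x)).aux out [] (d (val x)).cnt (Function.update val x i)
          (Function.update tmp x (val x - (i + 1))) rem) _)
      · simp [state]
      · simp [state, ← List.replicate_succ])
  have e : Function.update tmp x 0 = tmp := by rw [← ht, Function.update_eq_self]
  simp only [List.length_replicate, Nat.sub_zero, Function.update_eq_self, Nat.sub_self, e]
    at h₁ h₂
  refine (h₁.seq h₂).mono ?_
  -- With `m` the value of `x`, the first drain costs `m * (T + 3) + 2` and the second, which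
  -- restores `x`, costs `m * 3 + 2`.
  simp only [repeatTime]
  ring_nf
  omega

/-- Read one more bit of the input. -/
def readBit : Prog Stk :=
  .seq (.pop .inp fun v o => (o, v.2)) (.ite (fun v => v.1.isSome) (pushReg .aux) (.load id))

/-- The scratch contents after `c` bits of the input `w` were read. -/
def scratchAt (f : Bool) (w cnt : List Bool) (c : ℕ) : Scratch :=
  ⟨f, w.drop c, (w.take c).reverse, cnt⟩

/-- Past the end of the input the program changes nothing, in accordance with `take` and `drop`; so
no bound on `c` is needed. -/
theorem runs_readBit (f : Bool) (w cnt : List Bool) (c : ℕ) (out : List Bool)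
    (val tmp rem : Var → ℕ) :
    Runs readBit (state (scratchAt f w cnt c) out val tmp rem)
      (state (scratchAt f w cnt (c + 1)) out val tmp rem) 3 := by
  intro r
  by_cases hc : c < w.length
  · refine ⟨some w[c], (1 + 1) + 1, le_rfl, .seq (.pop ..) (.ite_true ?_ ?_)⟩
    · simp [state, scratchAt, hc]
    · refine cast ?_ (Exec.push .aux (fun v => v.1.getD false) (some w[c], f)
        (store (w.drop (c + 1)) (w.take c).reverse out [] cnt val tmp rem))
      simp only [state, scratchAt, List.take_succ_eq_append_getElem hc, List.reverse_append, pushReg]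
      simp [hc]
  · refine ⟨none, (1 + 1) + 1, le_rfl, .seq (.pop ..) (.ite_false ?_ ?_)⟩
    · simpa [state, scratchAt] using hc
    · refine cast ?_ (Exec.load id (none, f)
        (store [] w.reverse out [] cnt val tmp rem))
      have h₁ : w.length ≤ c := by omega
      have h₂ : w.length ≤ c + 1 := by omega
      simp only [state, scratchAt, List.take_of_length_le h₁, List.take_of_length_le h₂,
        List.drop_eq_nil_of_le h₁, List.drop_eq_nil_of_le h₂, store_inp, List.head?_nil,
        List.tail_nil, update_store_inp, id]

/-- Products of variables are computed by position: if one round advances the input by `a` bits,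
then the repetition advances it by `val x * a`. -/
theorem runs_repeat_read {x : Var} {p : Prog Stk} {T a c : ℕ} {f : Bool} {w cnt : List Bool}
    {out : List Bool} {val tmp rem : Var → ℕ} (ht : tmp x = 0)
    (h : ∀ c, ∀ val' tmp' : Var → ℕ, (∀ y ≠ x, val' y = val y) → (∀ y ≠ x, tmp' y = tmp y) →
      Runs p (state (scratchAt f w cnt c) out val' tmp' rem)
        (state (scratchAt f w cnt (c + a)) out val' tmp' rem) T) :
    Runs (repeatVar x p) (state (scratchAt f w cnt c) out val tmp rem)
      (state (scratchAt f w cnt (c + val x * a)) out val tmp rem) (repeatTime (val x) T) := by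
  have := runs_repeatVar (x := x) (p := p) (T := T) (fun i => scratchAt f w cnt (c + i * a))
    (out := out) (val := val) (tmp := tmp) (rem := rem) ht fun i _ val' tmp' hv ht => by
      simpa only [Nat.succ_mul, ← Nat.add_assoc] using h (c + i * a) val' tmp' hv ht
  simpa using this

end StackProgram

/-! ### Tests and commands with bounded loops, with their running times -/

namespace StackProgram

/-- The tests: whether two variables have the same value, and whether the input has a `true` at a
position of its first or second square matrix that is given by two variables. -/
inductive Test : Type
  | eq (x y : Var)
  | bit (second : Bool) (x y : Var)

namespace Test

/-- The value of a test, where `n` is the bound of the loops and `w` is the input. -/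
def eval (n : ℕ) (w : List Bool) (env : Var → ℕ) : Test → Bool
  | eq x y => decide (env x = env y)
  | bit second x y => w.getD ((if second then n * n else 0) + env x * n + env y) false

/-- The variable `4` is reserved. -/
def Good : Test → Prop
  | eq _ _ => True
  | bit _ x _ => x ≠ 4

/-- The program that writes the value of a test into the flag. -/
def compile : Test → Prog Stk
  | eq x y =>
    .seq (.load fun v => (v.1, true))
      (.seq (repeatVar x (.push .cnt fun _ => true))
        (.seq (repeatVar y (.pop .cnt fun v o => (o, v.2 && o.isSome)))
          (drain .cnt (.load fun v => (v.1, false)))))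
  | bit second x y =>
    .seq (if second then repeatVar 4 (repeatVar 5 readBit) else .load fun v => (v.1, v.2))
      (.seq (repeatVar x (repeatVar 4 readBit))
        (.seq (repeatVar y readBit)
          (.seq (.peek .inp fun _ o => (o, o.getD false)) (pour .aux .inp))))

/-- A bound for the number of steps that a test takes. -/
noncomputable def time : Polynomial ℕ :=
  repeatTime .X (repeatTime .X 3) * 2 + repeatTime .X 3 * 2 + (.X * .X + .X * .X + .X) * 3 + 10

end Test

/-- A counter is raised `env x` times and lowered `env y` times. The flag is lost if the counter is
ever found empty, that is, if `env x < env y`, or if something is left in the end, that is, if `env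
y < env x`. -/
theorem Runs.test_eq {n : ℕ} {f : Bool} {w out : List Bool} {env rem : Var → ℕ} (x y : Var)
    (henv : ∀ x, env x ≤ n) :
    Runs (Test.eq x y).compile (state ⟨f, w, [], []⟩ out env 0 rem)
      (state ⟨(Test.eq x y).eval n w env, w, [], []⟩ out env 0 rem)
      (1 + (repeatTime n 1 + (repeatTime n 1 + (n * 3 + 2)))) := by
  have h₁ := Runs.loadFlag (K := Stk) (fun _ => true) f
    (store w [] out [] [] env 0 rem)
  have h₂ := runs_repeatVar (x := x) (p := .push .cnt fun _ => true) (T := 1)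
    (fun i => ⟨true, w, [], List.replicate i true⟩) (out := out) (val := env) (tmp := 0)
    (rem := rem) rfl (fun i _ val' tmp' _ _ => by
      refine cast (congrArg (Runs _ _ · 1) ?_) (Runs.push (Stk.cnt) true true
        (store w [] out [] (List.replicate i true) val' tmp' rem))
      simp [state, ← List.replicate_succ])
  have h₃ := runs_repeatVar (x := y) (p := .pop .cnt fun v o => (o, v.2 && o.isSome)) (T := 1)
    (fun i => ⟨decide (i ≤ env x), w, [], List.replicate (env x - i) true⟩)
    (out := out) (val := env) (tmp := 0)
    (rem := rem) rfl (fun i _ val' tmp' _ _ => by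
      refine cast (congrArg (Runs _ _ · 1) ?_) (Runs.popFlag Stk.cnt (fun v o => v && o.isSome)
        (decide (i ≤ env x)) (store w [] out [] (List.replicate (env x - i) true) val' tmp' rem))
      simp only [state, Prod.mk.injEq, store_cnt, List.tail_replicate, update_store_cnt,
        Nat.sub_sub, and_true]
      by_cases hi : i < env x
      · have h1 : env x - i ≠ 0 := by omega
        simp [List.head?_replicate, h1, hi, hi.le]
      · have h1 : env x - i = 0 := by omega
        simp [h1, hi])
  have h₄ := Runs.drain (k := Stk.cnt) (p := .load fun v => (v.1, false)) (T := 1)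
    (List.replicate (env x - env y) true)
    (fun i => state ⟨decide (env y ≤ env x) && decide (i = 0), w, [],
      List.replicate (env x - env y - i) true⟩ out env 0 rem)
    (fun i _ => by simp [state]) (fun i hi => by
      refine cast (congrArg₂ (RunsFrom _ _ · · 1) ?_ ?_) (Runs.loadFlag (fun _ => false)
        (decide (env y ≤ env x) && decide (i = 0))
        (store w [] out [] (List.replicate (env x - env y - (i + 1)) true) env 0 rem) _)
      · simp [state]
      · simp [state])
  have e : (decide (env y ≤ env x) && decide (env x - env y = 0)) = decide (env x = env y) := by
    rw [← Bool.decide_and]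
    exact decide_eq_decide.2 (by omega)
  simp only [List.length_replicate, Nat.sub_zero, Nat.sub_self, Nat.zero_le, decide_true,
    Bool.and_true, List.replicate_zero, e] at h₂ h₃ h₄
  refine (h₁.seq (h₂.seq (h₃.seq h₄))).mono ?_
  have hx := repeatTime_mono (henv x) (le_refl 1)
  have hy := repeatTime_mono (henv y) (le_refl 1)
  have := henv x
  omega

/-- The position is reached by reading: `n * n` bits to skip the first matrix, `env x` rows of `n`
bits, and `env y` more bits. Then the head is inspected and the input is restored from `aux`. The
bound `n` is held twice, in variables `4` and `5`, because skipping a matrix nests two repetitions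
of length `n`; and `x ≠ 4` because the rows are skipped by a repetition over `4` inside one over
`x`. -/
theorem Runs.test_bit {n : ℕ} {f : Bool} {w out : List Bool} {env rem : Var → ℕ} (second : Bool)
    (x y : Var) (henv : ∀ x, env x ≤ n) (h4 : env 4 = n) (h5 : env 5 = n) (hx : x ≠ 4) :
    Runs (Test.bit second x y).compile (state ⟨f, w, [], []⟩ out env 0 rem)
      (state ⟨(Test.bit second x y).eval n w env, w, [], []⟩ out env 0 rem)
      ((repeatTime n (repeatTime n 3) + 1) + (repeatTime n (repeatTime n 3) +
        (repeatTime n 3 + (1 + ((n * n + n * n + n) * 3 + 2))))) := by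
  have h₁ : Runs (if second then repeatVar 4 (repeatVar 5 readBit)
      else .load fun v => (v.1, v.2))
      (state (scratchAt f w [] 0) out env 0 rem)
      (state (scratchAt f w [] (if second then n * n else 0)) out env 0 rem)
      (repeatTime n (repeatTime n 3) + 1) := by
    cases second with
    | true =>
      have := runs_repeat_read (x := 4) (p := repeatVar 5 readBit)
        (T := repeatTime n 3) (a := n) (c := 0)
        (f := f) (w := w) (cnt := []) (out := out) (val := env) (tmp := 0) (rem := rem) rfl
        (fun c val' tmp' hv ht => by
          have := runs_repeat_read (x := 5) (p := readBit) (T := 3) (a := 1) (c := c)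
            (f := f) (w := w) (cnt := []) (out := out) (val := val') (tmp := tmp') (rem := rem)
            (ht 5 (by decide)) fun c val' tmp' _ _ => runs_readBit f w [] c out val' tmp' rem
          simpa [hv 5 (by decide), h5] using this)
      simp only [h4, Nat.zero_add] at this
      exact this.mono (Nat.le_succ _)
    | false => exact (Runs.loadFlag id f _).mono (by omega)
  have h₂ := runs_repeat_read (x := x) (p := repeatVar 4 readBit)
    (T := repeatTime n 3) (a := n) (c := if second then n * n else 0)
    (f := f) (w := w) (cnt := []) (out := out) (val := env) (tmp := 0) (rem := rem) rfl
    (fun c val' tmp' hv ht => by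
      have := runs_repeat_read (x := 4) (p := readBit) (T := 3) (a := 1) (c := c)
        (f := f) (w := w) (cnt := []) (out := out) (val := val') (tmp := tmp') (rem := rem)
        (ht 4 hx.symm) fun c val' tmp' _ _ => runs_readBit f w [] c out val' tmp' rem
      simpa [hv 4 hx.symm, h4] using this)
  have h₃ := runs_repeat_read (x := y) (p := readBit) (T := 3) (a := 1)
    (c := (if second then n * n else 0) + env x * n)
    (f := f) (w := w) (cnt := []) (out := out) (val := env) (tmp := 0) (rem := rem) rfl
    fun c val' tmp' _ _ => runs_readBit f w [] c out val' tmp' rem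
  rw [Nat.mul_one] at h₃
  set c := (if second then n * n else 0) + env x * n + env y with hc
  have h₄ := Runs.peekFlag Stk.inp (fun _ o => o.getD false) f
    (state (scratchAt f w [] c) out env 0 rem).2
  have h₅ := Runs.pour (k := Stk.aux) (k' := Stk.inp) (by decide)
    (w.getD c false) (state (scratchAt f w [] c) out env 0 rem).2
  have hcn : c ≤ n * n + n * n + n := by
    have h1 : env x * n ≤ n * n := Nat.mul_le_mul_right n (henv x)
    have h2 := henv y
    have h3 : (if second then n * n else 0) ≤ n * n := by split <;> simp
    omega
  have e₁ : (state (scratchAt f w [] 0) out env 0 rem) = state ⟨f, w, [], []⟩ out env 0 rem := by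
    simp [state, scratchAt]
  have e₂ : (((state (scratchAt f w [] c) out env 0 rem).2 .inp).head?).getD false =
      w.getD c false := by
    simp [state, scratchAt, List.getD_eq_getElem?_getD]
  have e₃ : Function.update (Function.update (state (scratchAt f w [] c) out env 0 rem).2 .aux [])
      .inp (((state (scratchAt f w [] c) out env 0 rem).2 .aux).reverse ++
        (state (scratchAt f w [] c) out env 0 rem).2 .inp) =
      (state ⟨f, w, [], []⟩ out env 0 rem).2 := by
    simp [state, scratchAt]
  have e₄ : ((state (scratchAt f w [] c) out env 0 rem).2 .aux).length ≤ c := by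
    simp [state, scratchAt]
  rw [e₁] at h₁
  rw [e₂] at h₄
  rw [e₃] at h₅
  refine (h₁.seq (h₂.seq (h₃.seq (h₄.seq h₅)))).mono ?_
  have hx := repeatTime_mono (henv x) (le_refl (repeatTime n 3))
  have hy := repeatTime_mono (henv y) (le_refl 3)
  omega

theorem Runs.test {n : ℕ} {f : Bool} {w out : List Bool} {env rem : Var → ℕ} (t : Test)
    (ht : t.Good) (henv : ∀ x, env x ≤ n) (h4 : env 4 = n) (h5 : env 5 = n) :
    Runs t.compile (state ⟨f, w, [], []⟩ out env 0 rem)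
      (state ⟨t.eval n w env, w, [], []⟩ out env 0 rem) (Test.time.eval n) := by
  have e : Test.time.eval n = repeatTime n (repeatTime n 3) * 2 + repeatTime n 3 * 2 +
      (n * n + n * n + n) * 3 + 10 := by
    simp [Test.time, eval_repeatTime]
  rw [e]
  have h13 := repeatTime_mono (le_refl n) (show 1 ≤ 3 by decide)
  cases t with
  | eq x y =>
    refine (Runs.test_eq x y henv).mono ?_
    nlinarith
  | bit second x y =>
    refine (Runs.test_bit second x y henv h4 h5 ht).mono ?_
    omega

/-- Programs that write bits, with branching and with loops over all values below the bound. -/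
inductive Cmd : Type
  | nop : Cmd
  | emit (b : Bool) : Cmd
  | seq (c₁ c₂ : Cmd) : Cmd
  | ite (t : Test) (c₁ c₂ : Cmd) : Cmd
  | each (x : Var) (c : Cmd) : Cmd

namespace Cmd

/-- The bits that a program writes. -/
def output (n : ℕ) (w : List Bool) : (Var → ℕ) → Cmd → List Bool
  | _, nop => []
  | _, emit b => [b]
  | env, seq c₁ c₂ => output n w env c₁ ++ output n w env c₂
  | env, ite t c₁ c₂ => if t.eval n w env then output n w env c₁ else output n w env c₂
  | env, each x c => (List.range n).flatMap fun i => output n w (Function.update env x i) c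

/-- The tests are admissible, and the loop variables are distinct from those in `A`, which are the
reserved ones and those in use. -/
def Good : Finset Var → Cmd → Prop
  | _, nop => True
  | _, emit _ => True
  | A, seq c₁ c₂ => Good A c₁ ∧ Good A c₂
  | A, ite t c₁ c₂ => t.Good ∧ Good A c₁ ∧ Good A c₂
  | A, each x c => x ∉ A ∧ Good (insert x A) c

/-- The stack program that executes a program. -/
def compile : Cmd → Prog Stk
  | nop => .load id
  | emit b => .push .out fun _ => b
  | seq c₁ c₂ => .seq c₁.compile c₂.compile
  | ite t c₁ c₂ => .seq t.compile (.ite (fun v => v.2)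
      (.seq (.load fun v => (v.1, false)) c₁.compile)
      (.seq (.load fun v => (v.1, false)) c₂.compile))
  | each x c => .seq (drain (.rem x) (.seq c.compile (.push (.val x) fun _ => true)))
      (drain (.val x) (.push (.rem x) fun _ => true))

/-- A bound for the length of the output and the number of steps. -/
noncomputable def time : Cmd → Polynomial ℕ
  | nop => 1
  | emit _ => 1
  | seq c₁ c₂ => c₁.time + c₂.time
  | ite _ c₁ c₂ => Test.time + (c₁.time + c₂.time + 2)
  | each _ c => .X * (c.time + 6) + 4

/-- Each written bit costs a step, so the time bound also bounds the output. The length is needed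
because the output is poured to another stack in the end. -/
theorem length_output_le (n : ℕ) (w : List Bool) (env : Var → ℕ) (c : Cmd) :
    (c.output n w env).length ≤ c.time.eval n := by
  induction c generalizing env with
  | nop => simp [output, time]
  | emit b => simp [output, time]
  | seq c₁ c₂ ih₁ ih₂ => simpa [output, time] using Nat.add_le_add (ih₁ env) (ih₂ env)
  | ite t c₁ c₂ ih₁ ih₂ =>
    have := ih₁ env
    have := ih₂ env
    simp only [output, time, Polynomial.eval_add]
    split <;> omega
  | each x c ih =>
    have : ((List.range n).map fun i =>
        (output n w (Function.update env x i) c).length).sum ≤ n * c.time.eval n := by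
      have := List.sum_le_card_nsmul ((List.range n).map fun i =>
        (output n w (Function.update env x i) c).length) (c.time.eval n) (by
          intro l hl
          obtain ⟨i, _, rfl⟩ := List.mem_map.1 hl
          exact ih _)
      simpa using this
    simp only [output, time, List.length_flatMap]
    simp
    nlinarith

end Cmd

/-- Between commands every variable outside `A` has value `0` and `n` iterations left, all `tmp`
stacks are empty, and the flag is `false`. The output is accumulated on a stack, hence in reversed
order. -/
theorem Runs.cmd {n : ℕ} {w : List Bool} (c : Cmd) : ∀ {A : Finset Var} {out : List Bool}
    {env rem : Var → ℕ}, c.Good A → 4 ∈ A → 5 ∈ A → (∀ x, env x ≤ n) → env 4 = n → env 5 = n →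
    (∀ x ∉ A, env x = 0 ∧ rem x = n) →
    Runs c.compile (state ⟨false, w, [], []⟩ out env 0 rem)
      (state ⟨false, w, [], []⟩ ((c.output n w env).reverse ++ out) env 0 rem)
      (c.time.eval n) := by
  induction c with
  | nop =>
    intro A out env rem _ _ _ _ _ _ _
    exact (Runs.loadFlag id _ _).mono (by simp [Cmd.time])
  | emit b =>
    intro A out env rem _ _ _ _ _ _ _
    refine cast (congrArg (Runs _ _ · _) ?_) ((Runs.push Stk.out b _ _).mono
      (by simp [Cmd.time] : 1 ≤ (Cmd.emit b).time.eval n))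
    simp [state, Cmd.output]
  | seq c₁ c₂ ih₁ ih₂ =>
    intro A out env rem hA h4A h5A henv h4 h5 h
    have h₁ := ih₁ (out := out) hA.1 h4A h5A henv h4 h5 h
    have h₂ := ih₂ (out := (c₁.output n w env).reverse ++ out) hA.2 h4A h5A henv h4 h5 h
    simpa [Cmd.output, Cmd.time, Cmd.compile] using h₁.seq h₂
  | ite t c₁ c₂ ih₁ ih₂ =>
    intro A out env rem hA h4A h5A henv h4 h5 h
    have h₀ := Runs.test (f := false) (w := w) (out := out) (rem := rem) t hA.1 henv h4 h5
    have h₁ := ih₁ (out := out) hA.2.1 h4A h5A henv h4 h5 h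
    have h₂ := ih₂ (out := out) hA.2.2 h4A h5A henv h4 h5 h
    have hl : ∀ f, Runs (.load fun v => (v.1, false)) (state ⟨f, w, [], []⟩ out env 0 rem)
        (state ⟨false, w, [], []⟩ out env 0 rem) 1 := fun f => Runs.loadFlag (fun _ => false) f _
    have h₃ : Runs (.ite (fun v => v.2)
        (.seq (.load fun v => (v.1, false)) c₁.compile)
        (.seq (.load fun v => (v.1, false)) c₂.compile))
        (state ⟨t.eval n w env, w, [], []⟩ out env 0 rem)
        (state ⟨false, w, [], []⟩ (((Cmd.ite t c₁ c₂).output n w env).reverse ++ out) env 0 rem)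
        (c₁.time.eval n + c₂.time.eval n + 1 + 1) := by
      refine Runs.iteFlag ?_
      rw [Cmd.output]
      cases ht : t.eval n w env with
      | true => exact ((hl true).seq h₁).mono (by omega)
      | false => exact ((hl false).seq h₂).mono (by omega)
    refine (h₀.seq h₃).mono ?_
    simp [Cmd.time]
  | each x c ih =>
    intro A out env rem hA h4A h5A henv h4 h5 h
    obtain ⟨hx, hA⟩ := hA
    obtain ⟨hx₀, hx₁⟩ := h x hx
    have h4x : 4 ≠ x := fun h => hx (h ▸ h4A)
    have h5x : 5 ≠ x := fun h => hx (h ▸ h5A)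
    -- Tokens move from `rem x` to `val x`, so that `x` has the value `i` in round `i`; the second
    -- drain moves all of them back.
    have h₁ := Runs.drain (k := .rem x) (p := .seq c.compile (.push (.val x) fun _ => true))
      (T := c.time.eval n + 1) (List.replicate n true)
      (fun i => state ⟨false, w, [], []⟩
        ((((List.range i).flatMap fun i => c.output n w (Function.update env x i))).reverse ++ out)
        (Function.update env x i) 0 (Function.update rem x (n - i)))
      (fun i _ => by simp [state]) (fun i hi => by
        rw [List.length_replicate] at hi
        have h₀ := ih (A := insert x A) (out := (((List.range i).flatMap fun i =>
            c.output n w (Function.update env x i))).reverse ++ out)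
          (env := Function.update env x i) (rem := Function.update rem x (n - (i + 1))) hA
          (by simp [h4A]) (by simp [h5A])
          (by
            intro y
            by_cases hy : y = x
            · subst hy; simpa using hi.le
            · simpa [hy] using henv y)
          (by simpa [h4x] using h4) (by simpa [h5x] using h5)
          (by
            intro y hy
            rw [Finset.mem_insert, not_or] at hy
            simpa [hy.1] using h y hy.2)
        refine cast (congrArg₂ (RunsFrom _ _ · · _) ?_ ?_)
          ((h₀.seq (Runs.push (Stk.val x) true _ _)) _)
        · simp [state]
        · simp [state, List.range_succ, ← List.replicate_succ])
    have h₂ := Runs.drain (k := .val x) (p := .push (.rem x) fun _ => true) (T := 1)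
      (List.replicate n true)
      (fun i => state ⟨false, w, [], []⟩
        ((((List.range n).flatMap fun i => c.output n w (Function.update env x i))).reverse ++ out)
        (Function.update env x (n - i)) 0 (Function.update rem x i))
      (fun i _ => by simp [state]) (fun i hi => by
        refine cast (congrArg₂ (RunsFrom _ _ · · 1) ?_ ?_) (Runs.push (Stk.rem x) true false
          (store w [] ((((List.range n).flatMap fun i =>
            c.output n w (Function.update env x i))).reverse ++ out) [] []
            (Function.update env x (n - (i + 1))) 0 (Function.update rem x i)) _)
        · simp [state]
        · simp [state, ← List.replicate_succ])
    have e₁ : Function.update env x 0 = env := by rw [← hx₀, Function.update_eq_self]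
    have e₂ : Function.update rem x n = rem := by rw [← hx₁, Function.update_eq_self]
    simp only [List.length_replicate, Nat.sub_zero, Nat.sub_self, e₁, e₂, List.range_zero,
      List.flatMap_nil, List.reverse_nil, List.nil_append] at h₁ h₂
    refine (h₁.seq h₂).mono ?_
    simp [Cmd.time]
    ring_nf
    omega

end StackProgram

namespace StackProgram

/-! ### Programs that read and write their input and output -/

/-- The initial values of the variables. -/
def initialVal (n : ℕ) (x : Var) : ℕ := if x = 4 ∨ x = 5 then n else 0

/-- The initial numbers of remaining iterations. -/
def initialRem (n : ℕ) (x : Var) : ℕ := if x = 4 ∨ x = 5 then 0 else n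

theorem Runs.loopFlag_false {K : Type} [DecidableEq K] {p : Prog K} {S : K → List Bool} :
    Runs (.loop (fun v => v.2) p) (false, S) (false, S) 1 :=
  fun r => ⟨r, 1, le_rfl, .loop_false rfl⟩

theorem Runs.loopFlag_true {K : Type} [DecidableEq K] {p : Prog K} {S : K → List Bool}
    {s₂ s₃ : Bool × (K → List Bool)} {T₁ T₂ : ℕ} (h₁ : Runs p (true, S) s₂ T₁)
    (h₂ : Runs (.loop (fun v => v.2) p) s₂ s₃ T₂) :
    Runs (.loop (fun v => v.2) p) (true, S) s₃ (T₁ + 1 + T₂) := by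
  intro r
  obtain ⟨r₂, t₁, ht₁, h₁⟩ := h₁ r
  obtain ⟨r₃, t₂, ht₂, h₂⟩ := h₂ r₂
  exact ⟨r₃, _, by omega, .loop_true rfl h₁ h₂⟩

/-- Increment the initial values, and read a bit. -/
def readUnit : Prog Stk :=
  .seq (.push (.rem 0) fun _ => true) (.seq (.push (.rem 1) fun _ => true)
    (.seq (.push (.rem 2) fun _ => true) (.seq (.push (.rem 3) fun _ => true)
      (.seq (.push (.val 4) fun _ => true) (.seq (.push (.val 5) fun _ => true)
        (.pop .inp fun _ o => (o, o.getD false)))))))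

theorem runs_readUnit (m : ℕ) (b : Bool) (w : List Bool) :
    Runs readUnit (state ⟨true, b :: w, [], []⟩ [] (initialVal m) 0 (initialRem m))
      (state ⟨b, w, [], []⟩ [] (initialVal (m + 1)) 0 (initialRem (m + 1))) 7 := by
  refine cast (congrArg (Runs _ _ · _) ?_) ((Runs.push (Stk.rem 0) true true _).seq
    ((Runs.push (Stk.rem 1) true true _).seq ((Runs.push (Stk.rem 2) true true _).seq
    ((Runs.push (Stk.rem 3) true true _).seq ((Runs.push (Stk.val 4) true true _).seq
    ((Runs.push (Stk.val 5) true true _).seq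
    (Runs.popFlag Stk.inp (fun _ o => o.getD false) true _)))))))
  refine Prod.ext ?_ (funext fun k => ?_)
  · simp [state]
  · rcases k with _ | _ | _ | _ | _ | x | x | x
    case val | rem =>
      fin_cases x <;> simp [state, store, initialVal, initialRem, List.replicate_succ]
    all_goals simp [state]

/-- Read a number in unary. -/
def readBound : Prog Stk :=
  .seq (.pop .inp fun _ o => (o, o.getD false)) (.loop (fun v => v.2) readUnit)

/-- The flag `true` says that a unit has been popped but not yet counted, which accounts for `n + 1`
where only `n` units are left on the stack. -/
theorem runs_readBound_loop (w : List Bool) : ∀ n m : ℕ,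
    Runs (.loop (fun v => v.2) readUnit)
      (state ⟨true, List.replicate n true ++ false :: w, [], []⟩ [] (initialVal m) 0
        (initialRem m))
      (state ⟨false, w, [], []⟩ [] (initialVal (m + (n + 1))) 0 (initialRem (m + (n + 1))))
      ((n + 1) * 8 + 1)
  | 0, m => (Runs.loopFlag_true (runs_readUnit m false w) Runs.loopFlag_false).mono (by omega)
  | n + 1, m => by
    have ih := runs_readBound_loop w n (m + 1)
    rw [Nat.add_right_comm, Nat.add_assoc] at ih
    exact (Runs.loopFlag_true (runs_readUnit m true _) ih).mono (by omega)

theorem runs_readBound (w : List Bool) (n : ℕ) :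
    Runs readBound (false, store (List.replicate n true ++ false :: w) [] [] [] [] 0 0 0)
      (state ⟨false, w, [], []⟩ [] (initialVal n) 0 (initialRem n)) (n * 8 + 2) := by
  have e₁ : initialVal 0 = 0 := by funext x; simp [initialVal]
  have e₂ : initialRem 0 = 0 := by funext x; simp [initialRem]
  have h₁ := Runs.popFlag Stk.inp (fun _ o => o.getD false) false
    (store (List.replicate n true ++ false :: w) [] [] [] [] 0 0 0)
  cases n with
  | zero =>
    have h₂ : Runs (.loop (fun v => v.2) readUnit) (false, store w [] [] [] [] 0 0 0)
      (false, store w [] [] [] [] 0 0 0) 1 := Runs.loopFlag_false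
    refine Runs.mono (Runs.seq h₁ (T₂ := 1) ?_) (by omega)
    simpa [e₁, e₂, state] using h₂
  | succ n =>
    have h₂ := runs_readBound_loop w n 0
    simp only [e₁, e₂, Nat.zero_add] at h₂
    refine Runs.mono (Runs.seq h₁ (T₂ := (n + 1) * 8 + 1) ?_) (by omega)
    simpa [List.replicate_succ, state] using h₂

/-- Write the output and clear all other stacks. -/
def finish : Prog Stk :=
  .seq (pour .out .res) (.seq (clear .inp) (.seq (clear (.rem 0)) (.seq (clear (.rem 1))
    (.seq (clear (.rem 2)) (.seq (clear (.rem 3)) (.seq (clear (.val 4)) (clear (.val 5))))))))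

theorem runs_finish (w out : List Bool) (n : ℕ) :
    Runs finish (state ⟨false, w, [], []⟩ out (initialVal n) 0 (initialRem n))
      (false, store [] [] [] out.reverse [] 0 0 0)
      (out.length * 3 + w.length * 3 + n * 18 + 16) := by
  have h := (Runs.pour (k := Stk.out) (k' := .res) (by decide) false
    (state ⟨false, w, [], []⟩ out (initialVal n) 0 (initialRem n)).2).seq
    ((Runs.clear Stk.inp false _).seq ((Runs.clear (Stk.rem 0) false _).seq
    ((Runs.clear (Stk.rem 1) false _).seq ((Runs.clear (Stk.rem 2) false _).seq
    ((Runs.clear (Stk.rem 3) false _).seq ((Runs.clear (Stk.val 4) false _).seq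
    (Runs.clear (Stk.val 5) false _)))))))
  refine Runs.mono (cast (congrArg (Runs _ _ · _) ?_) h) ?_
  · refine Prod.ext rfl (funext fun k => ?_)
    rcases k with _ | _ | _ | _ | _ | x | x | x
    case val | rem => fin_cases x <;> simp [state, store, initialVal, initialRem]
    all_goals simp [state]
  · simp [state, initialVal, initialRem]
    omega

/-- The stack program that reads the bound and the input of a program, executes it, and writes its
output. -/
def Cmd.program (c : Cmd) : Prog Stk :=
  .seq readBound (.seq c.compile (.seq finish (.load fun _ => (none, false))))

/-- A bound for the number of steps that `Cmd.program` takes. -/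
noncomputable def Cmd.programTime (c : Cmd) : Polynomial ℕ :=
  c.time * 4 + .X * 29 + 19

theorem exec_program {n : ℕ} {w : List Bool} {c : Cmd} (hc : c.Good {4, 5}) :
    ∃ t ≤ c.programTime.eval (List.replicate n true ++ false :: w).length,
      Exec c.program
        ((none, false), Function.update (fun _ => []) .inp (List.replicate n true ++ false :: w))
        ((none, false), Function.update (fun _ => []) .res (c.output n w (initialVal n))) t := by
  have h₁ := runs_readBound w n
  have h₂ := Runs.cmd (n := n) (w := w) c (out := []) (env := initialVal n) (rem := initialRem n)
    hc (by simp) (by simp) (fun x => by unfold initialVal; split <;> simp) (by simp [initialVal])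
    (by simp [initialVal]) fun x hx => by
      have hx' : ¬(x = 4 ∨ x = 5) := by simpa using hx
      simp [initialVal, initialRem, hx']
  have h₃ := runs_finish w ((c.output n w (initialVal n)).reverse ++ []) n
  obtain ⟨r₁, t₁, ht₁, h₁⟩ := h₁ none
  obtain ⟨r₂, t₂, ht₂, h₂⟩ := h₂ r₁
  obtain ⟨r₃, t₃, ht₃, h₃⟩ := h₃ r₂
  have e₁ : store (List.replicate n true ++ false :: w) [] [] [] [] 0 0 0 =
      Function.update (fun _ => []) .inp (List.replicate n true ++ false :: w) := by
    funext k; cases k <;> simp [Function.update]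
  have e₂ : store [] [] [] ((c.output n w (initialVal n)).reverse ++ []).reverse [] 0 0 0 =
      Function.update (fun _ => []) .res (c.output n w (initialVal n)) := by
    funext k; cases k <;> simp [Function.update]
  rw [e₁] at h₁
  rw [e₂] at h₃
  refine ⟨_, ?_, .seq h₁ (.seq h₂ (.seq h₃ (.load ..)))⟩
  have hlen := c.length_output_le n w (initialVal n)
  -- The time of the command is polynomial in `n`, but the bound is wanted in the length of the
  -- input; polynomials over `ℕ` are monotone.
  have hmono : c.time.eval n ≤ c.time.eval (n + (w.length + 1)) := by
    rw [Polynomial.eval_eq_sum, Polynomial.eval_eq_sum]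
    exact Finset.sum_le_sum fun i _ =>
      Nat.mul_le_mul_left _ (Nat.pow_le_pow_left (by omega) i)
  simp only [List.length_append, List.length_reverse, List.length_nil] at ht₃
  simp [Cmd.programTime]
  omega

/-- A function is computable in polynomial time if a program with bounded loops computes it. -/
theorem polyTimeComputable_of_cmd {α β : Type} {ea : α → List Bool} {eb : β → List Bool}
    {f : α → β} (c : Cmd) (hc : c.Good {4, 5}) (n : α → ℕ) (w : α → List Bool)
    (ha : ∀ a, ea a = List.replicate (n a) true ++ false :: w a)
    (hb : ∀ a, eb (f a) = c.output (n a) (w a) (initialVal (n a))) :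
    RVC.PolyTimeComputable ea eb f := by
  refine polyTimeComputable_of_exec c.program .inp .res c.programTime fun a => ?_
  rw [ha, hb]
  exact exec_program hc

end StackProgram

namespace StackProgram

/-! ### Boolean combinations of tests -/

/-- Boolean combinations of tests. -/
inductive BExp : Type
  | tt : BExp
  | ff : BExp
  | test (t : Test) : BExp
  | not (b : BExp) : BExp
  | and (b₁ b₂ : BExp) : BExp
  | or (b₁ b₂ : BExp) : BExp

namespace BExp

/-- The value of a Boolean combination of tests. -/
def eval (n : ℕ) (w : List Bool) (env : Var → ℕ) : BExp → Bool
  | tt => true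
  | ff => false
  | test t => t.eval n w env
  | not b => !b.eval n w env
  | and b₁ b₂ => b₁.eval n w env && b₂.eval n w env
  | or b₁ b₂ => b₁.eval n w env || b₂.eval n w env

/-- All tests are admissible. -/
def Good : BExp → Prop
  | tt => True
  | ff => True
  | test t => t.Good
  | not b => b.Good
  | and b₁ b₂ => b₁.Good ∧ b₂.Good
  | or b₁ b₂ => b₁.Good ∧ b₂.Good

/-- Branching according to a Boolean combination of tests. -/
def branch : BExp → Cmd → Cmd → Cmd
  | tt, c₁, _ => c₁
  | ff, _, c₂ => c₂
  | test t, c₁, c₂ => .ite t c₁ c₂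
  | not b, c₁, c₂ => b.branch c₂ c₁
  | and b₁ b₂, c₁, c₂ => b₁.branch (b₂.branch c₁ c₂) c₂
  | or b₁ b₂, c₁, c₂ => b₁.branch c₁ (b₂.branch c₁ c₂)

theorem output_branch (n : ℕ) (w : List Bool) (env : Var → ℕ) (b : BExp) (c₁ c₂ : Cmd) :
    (b.branch c₁ c₂).output n w env =
      if b.eval n w env then c₁.output n w env else c₂.output n w env := by
  induction b generalizing c₁ c₂ with
  | tt => simp [branch, eval]
  | ff => simp [branch, eval]
  | test t => rfl
  | not b ih => cases h : b.eval n w env <;> simp [branch, eval, ih, h]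
  | and b₁ b₂ ih₁ ih₂ =>
    cases h₁ : b₁.eval n w env <;> cases h₂ : b₂.eval n w env <;>
      simp [branch, eval, ih₁, ih₂, h₁, h₂]
  | or b₁ b₂ ih₁ ih₂ =>
    cases h₁ : b₁.eval n w env <;> cases h₂ : b₂.eval n w env <;>
      simp [branch, eval, ih₁, ih₂, h₁, h₂]

theorem Good.branch {b : BExp} {A : Finset Var} {c₁ c₂ : Cmd} (hb : b.Good) (h₁ : c₁.Good A)
    (h₂ : c₂.Good A) : (b.branch c₁ c₂).Good A := by
  induction b generalizing c₁ c₂ with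
  | tt => exact h₁
  | ff => exact h₂
  | test t => exact ⟨hb, h₁, h₂⟩
  | not b ih => exact ih hb h₂ h₁
  | and b₁ b₂ ih₁ ih₂ => exact ih₁ hb.1 (ih₂ hb.2 h₁ h₂) h₂
  | or b₁ b₂ ih₁ ih₂ => exact ih₁ hb.1 h₁ (ih₂ hb.2 h₁ h₂)

end BExp

/-! ### Enumerations of vertices -/

/-- A family of vertices may consist of a single vertex, or have a vertex for each number below the
bound, or have a vertex for each pair of such numbers that is in neither order in the second matrix
of the input. -/
inductive Kind : Type
  | single | vert | pair

/-- The expression that says that neither `(x, y)` nor `(y, x)` is in the second matrix. -/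
def nonPairExp (x y : Var) : BExp :=
  .and (.not (.test (.bit true x y))) (.not (.test (.bit true y x)))

/-- The pairs that are in neither order in the second matrix. -/
def isNonPair (n : ℕ) (w : List Bool) (i j : ℕ) : Bool :=
  !w.getD (n * n + i * n + j) false && !w.getD (n * n + j * n + i) false

section Codes

variable {ι : Type}

/-- The pairs of numbers that belong to a kind of families. -/
def Kind.codes (n : ℕ) (w : List Bool) : Kind → List (ℕ × ℕ)
  | single => [(0, 0)]
  | vert => (List.range n).map fun i => (i, 0)
  | pair => (List.range n).flatMap fun i =>
      ((List.range n).filter fun j => isNonPair n w i j).map fun j => (i, j)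

theorem Kind.nodup_codes (n : ℕ) (w : List Bool) (κ : Kind) : (κ.codes n w).Nodup := by
  cases κ with
  | single => simp [Kind.codes]
  | vert => exact List.nodup_range.map fun i j h => by simpa using h
  | pair =>
    refine List.nodup_flatMap.2 ⟨fun i _ =>
      (List.nodup_range.filter _).map fun a b h => by simpa using h, ?_⟩
    refine List.nodup_range.imp ?_
    intro i j hij
    simp only [Function.onFun, List.disjoint_left, List.mem_map]
    rintro _ ⟨a, _, rfl⟩ ⟨b, _, h⟩
    exact hij (by simpa using (congrArg Prod.fst h).symm)

/-- Names for the vertices of the given families. -/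
def codes (n : ℕ) (w : List Bool) (tags : List ι) (kind : ι → Kind) : List (ι × ℕ × ℕ) :=
  tags.flatMap fun t => ((kind t).codes n w).map fun c => (t, c)

theorem mem_codes {n : ℕ} {w : List Bool} {tags : List ι} {kind : ι → Kind} {c : ι × ℕ × ℕ} :
    c ∈ codes n w tags kind ↔ c.1 ∈ tags ∧ c.2 ∈ (kind c.1).codes n w := by
  obtain ⟨t, c⟩ := c
  simp only [codes, List.mem_flatMap, List.mem_map, Prod.mk.injEq]
  constructor
  · rintro ⟨t, ht, c, hc, rfl, rfl⟩
    exact ⟨ht, hc⟩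
  · rintro ⟨ht, hc⟩
    exact ⟨t, ht, c, hc, rfl, rfl⟩

theorem nodup_codes (n : ℕ) (w : List Bool) {tags : List ι} (h : tags.Nodup) (kind : ι → Kind) :
    (codes n w tags kind).Nodup := by
  refine List.nodup_flatMap.2 ⟨fun t _ =>
    (Kind.nodup_codes n w (kind t)).map fun a b h => by simpa using h, ?_⟩
  refine h.imp ?_
  intro i j hij
  simp only [Function.onFun, List.disjoint_left, List.mem_map]
  rintro _ ⟨a, _, rfl⟩ ⟨b, _, h⟩
  exact hij (by simpa using (congrArg Prod.fst h).symm)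

/-- Execute a program for each vertex of a family. -/
def Kind.forVertices (x y : Var) (c : Cmd) : Kind → Cmd
  | single => c
  | vert => .each x c
  | pair => .each x (.each y ((nonPairExp x y).branch c .nop))

/-- Execute a program for each vertex. -/
def forVertices (kind : ι → Kind) (x y : Var) (body : ι → Cmd) : List ι → Cmd
  | [] => .nop
  | t :: l => .seq ((kind t).forVertices x y (body t)) (forVertices kind x y body l)

theorem flatMap_filter_map {α β γ : Type} (p : α → Bool) (f : α → β) (g : β → List γ)
    (l : List α) :
    ((l.filter p).map f).flatMap g = l.flatMap fun a => if p a then g (f a) else [] := by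
  induction l with
  | nil => rfl
  | cons a l ih => cases h : p a <;> simp [h, ih]

/-- The loops visit the vertices in the order of `codes`. A kind that does not use one of the
variables leaves it at `0`, the default coordinate in its names; this is where `hx` and `hy` enter.
-/
theorem Kind.output_forVertices (n : ℕ) (w : List Bool) {x y : Var} (hxy : x ≠ y) (c : Cmd)
    {env : Var → ℕ} (hx : env x = 0) (hy : env y = 0) (κ : Kind) :
    (κ.forVertices x y c).output n w env = (κ.codes n w).flatMap fun a =>
      c.output n w (Function.update (Function.update env x a.1) y a.2) := by
  have ex : Function.update env x 0 = env := by rw [← hx, Function.update_eq_self]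
  have ey : ∀ i, Function.update (Function.update env x i) y 0 = Function.update env x i := by
    intro i
    refine Function.update_eq_self_iff.2 ?_
    rw [Function.update_of_ne hxy.symm, hy]
  have e : Function.update env y 0 = env := by rw [← hy, Function.update_eq_self]
  cases κ with
  | single => simp [Kind.forVertices, Kind.codes, e, ex]
  | vert => simp [Kind.forVertices, Kind.codes, ey, Cmd.output, List.flatMap_map]
  | pair =>
    simp only [Kind.forVertices, Kind.codes, Cmd.output, BExp.output_branch, List.flatMap_assoc,
      flatMap_filter_map]
    refine List.flatMap_congr fun i _ => List.flatMap_congr fun j _ => ?_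
    have : (nonPairExp x y).eval n w (Function.update (Function.update env x i) y j) =
        isNonPair n w i j := by
      simp [nonPairExp, isNonPair, BExp.eval, Test.eval, hxy, Function.update_of_ne]
    rw [this]

theorem output_forVertices (n : ℕ) (w : List Bool) (kind : ι → Kind) {x y : Var} (hxy : x ≠ y)
    (body : ι → Cmd) {env : Var → ℕ} (hx : env x = 0) (hy : env y = 0) (tags : List ι) :
    (forVertices kind x y body tags).output n w env = (codes n w tags kind).flatMap fun c =>
      (body c.1).output n w (Function.update (Function.update env x c.2.1) y c.2.2) := by
  induction tags with
  | nil => rfl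
  | cons t l ih =>
    rw [forVertices, Cmd.output, ih, Kind.output_forVertices n w hxy (body t) hx hy, codes, codes,
      List.flatMap_cons, List.flatMap_append, List.flatMap_map]

theorem Cmd.Good.mono {c : Cmd} : ∀ {A B : Finset Var}, A ⊆ B → c.Good B → c.Good A := by
  induction c with
  | nop => intros; trivial
  | emit b => intros; trivial
  | seq c₁ c₂ ih₁ ih₂ => exact fun h hc => ⟨ih₁ h hc.1, ih₂ h hc.2⟩
  | ite t c₁ c₂ ih₁ ih₂ => exact fun h hc => ⟨hc.1, ih₁ h hc.2.1, ih₂ h hc.2.2⟩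
  | each x c ih =>
    exact fun h hc => ⟨fun hx => hc.1 (h hx), ih (Finset.insert_subset_insert x h) hc.2⟩

theorem good_forVertices (kind : ι → Kind) {x y : Var} (hxy : x ≠ y) {body : ι → Cmd}
    {A : Finset Var} (hx : x ∉ A) (hy : y ∉ A) (h4 : 4 ∈ A)
    (h : ∀ t, (body t).Good (insert y (insert x A))) (tags : List ι) :
    (forVertices kind x y body tags).Good A := by
  induction tags with
  | nil => trivial
  | cons t l ih =>
    refine ⟨?_, ih⟩
    have hA : A ⊆ insert y (insert x A) :=
      (Finset.subset_insert x A).trans (Finset.subset_insert y _)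
    cases kind t with
    | single => exact (h t).mono hA
    | vert => exact ⟨hx, (h t).mono (Finset.subset_insert y _)⟩
    | pair =>
      refine ⟨hx, ?_, BExp.Good.branch ?_ (h t) trivial⟩
      · rw [Finset.mem_insert, not_or]
        exact ⟨hxy.symm, hy⟩
      · exact ⟨fun h => hx (h ▸ h4), fun h => hy (h ▸ h4)⟩

end Codes

/-- The program that writes the encoding of a graph: the families of its vertices are `tags`, and
`rel` describes its edges. -/
def graphCmd {ι : Type} (tags : List ι) (kind : ι → Kind)
    (rel : ι → ι → Var → Var → Var → Var → BExp) : Cmd :=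
  .seq (forVertices kind 0 1 (fun _ => .emit true) tags)
    (.seq (.emit false) (forVertices kind 0 1 (fun t => forVertices kind 2 3
      (fun t' => (rel t t' 0 1 2 3).branch (.emit true) (.emit false)) tags) tags))

theorem good_graphCmd {ι : Type} (tags : List ι) (kind : ι → Kind)
    (rel : ι → ι → Var → Var → Var → Var → BExp) (h : ∀ t t', (rel t t' 0 1 2 3).Good) :
    (graphCmd tags kind rel).Good {4, 5} := by
  refine ⟨good_forVertices kind (by decide) (by decide) (by decide) (by decide)
    (fun _ => show (Cmd.emit true).Good _ from trivial) _, trivial, good_forVertices kind (by decide) (by decide) (by decide)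
    (by decide) (fun t => good_forVertices kind (by decide) (by decide) (by decide)
    (by decide) (fun t' => (h t t').branch
    (show (Cmd.emit true).Good _ from trivial) (show (Cmd.emit false).Good _ from trivial)) _) _⟩

/-- The environment in which the names of two vertices are stored. -/
def pairEnv (n : ℕ) (a b : ℕ × ℕ) : Var → ℕ :=
  Function.update (Function.update (Function.update (Function.update (initialVal n) 0 a.1) 1 a.2)
    2 b.1) 3 b.2

theorem output_graphCmd {ι : Type} (n : ℕ) (w : List Bool) (tags : List ι) (kind : ι → Kind)
    (rel : ι → ι → Var → Var → Var → Var → BExp) :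
    (graphCmd tags kind rel).output n w (initialVal n) =
      List.replicate (codes n w tags kind).length true ++ false ::
        (codes n w tags kind).flatMap fun a => (codes n w tags kind).map fun b =>
          (rel a.1 b.1 0 1 2 3).eval n w (pairEnv n a.2 b.2) := by
  have h0 : initialVal n 0 = 0 := by simp [initialVal]
  have h1 : initialVal n 1 = 0 := by simp [initialVal]
  have h2 : initialVal n 2 = 0 := by simp [initialVal]
  have h3 : initialVal n 3 = 0 := by simp [initialVal]
  rw [graphCmd, Cmd.output, Cmd.output, output_forVertices n w kind (by decide) _ h0 h1,
    output_forVertices n w kind (by decide) _ h0 h1]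
  congr 1
  · simp only [Cmd.output]
    rw [← List.map_eq_flatMap, List.map_const']
  · rw [Cmd.output, List.singleton_append]
    congr 1
    refine List.flatMap_congr fun a _ => ?_
    rw [output_forVertices n w kind (by decide) _ (by simp [h2]) (by simp [h3]),
      List.map_eq_flatMap]
    refine List.flatMap_congr fun b _ => ?_
    rw [BExp.output_branch]
    simp only [Cmd.output, pairEnv]
    cases (rel a.1 b.1 0 1 2 3).eval n w _ <;> rfl

/-- Names for the elements of a type with a binary relation, such that the relation is described by
`rel` in terms of the names. -/
structure Naming {ι : Type} (n : ℕ) (w : List Bool) (tags : List ι) (kind : ι → Kind)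
    (rel : ι → ι → Var → Var → Var → Var → BExp) {α : Type} (A : α → α → Prop) where
  /-- the family of an element -/
  tag : α → ι
  /-- the pair of numbers that belongs to an element -/
  nums : α → ℕ × ℕ
  inj : ∀ a b, tag a = tag b → nums a = nums b → a = b
  mem : ∀ a, tag a ∈ tags ∧ nums a ∈ (kind (tag a)).codes n w
  surj : ∀ t ∈ tags, ∀ c ∈ (kind t).codes n w, ∃ a, tag a = t ∧ nums a = c
  rel_iff : ∀ a b (env : Var → ℕ) (x y x' y' : Var), env x = (nums a).1 → env y = (nums a).2 →
    env x' = (nums b).1 → env y' = (nums b).2 →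
    ((rel (tag a) (tag b) x y x' y').eval n w env = true ↔ A a b)

theorem flatMap_finRange_length {α β : Type} (l : List α) (f : α → List β) :
    ((List.finRange l.length).flatMap fun i => f l[i]) = l.flatMap f := by
  conv_rhs => rw [← List.map_getElem_finRange l, List.flatMap_map]
  rfl

theorem map_finRange_length {α β : Type} (l : List α) (f : α → β) :
    ((List.finRange l.length).map fun i => f l[i]) = l.map f := by
  conv_rhs => rw [← List.map_getElem_finRange l, List.map_map]
  rfl

/-- The list `codes` enumerates the names without repetition, so sending an index to the vertex with
that name is a bijection. Transporting `G` along it gives a graph on `Fin m` whose adjacency matrix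
is what the program prints. This is why the reduction yields `G_k` only up to isomorphism. -/
theorem Naming.exists_equiv {ι : Type} {n : ℕ} {w : List Bool} {tags : List ι} {kind : ι → Kind}
    {rel : ι → ι → Var → Var → Var → Var → BExp} {α : Type} {G : SimpleGraph α}
    (N : Naming n w tags kind rel G.Adj) (htags : tags.Nodup) :
    ∃ (m : ℕ) (e : Fin m ≃ α),
      RVC.encodeGraph ⟨m, G.comap e⟩ = (graphCmd tags kind rel).output n w (initialVal n) := by
  have hnodup := nodup_codes n w htags kind
  set l := codes n w tags kind with hl
  have hex : ∀ i : Fin l.length, ∃ a, N.tag a = l[i].1 ∧ N.nums a = l[i].2 := by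
    intro i
    have := mem_codes.1 (l.getElem_mem i.2)
    exact N.surj _ this.1 _ this.2
  choose e he₁ he₂ using hex
  have hbij : Function.Bijective e := by
    constructor
    · intro i j hij
      have : l[i] = l[j] := Prod.ext (by rw [← he₁, ← he₁, hij]) (by rw [← he₂, ← he₂, hij])
      exact Fin.ext ((List.Nodup.getElem_inj_iff hnodup).1 this)
    · intro a
      obtain ⟨i, hi, h⟩ := List.mem_iff_getElem.1
        (mem_codes.2 (N.mem a) : ((N.tag a, N.nums a) : ι × ℕ × ℕ) ∈ l)
      refine ⟨⟨i, hi⟩, N.inj _ _ ?_ ?_⟩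
      · rw [he₁]; exact congrArg Prod.fst h
      · rw [he₂]; exact congrArg Prod.snd h
  refine ⟨l.length, Equiv.ofBijective e hbij, ?_⟩
  rw [output_graphCmd, ← hl, RVC.encodeGraph]
  congr 2
  rw [RVC.relBits, ← flatMap_finRange_length l]
  refine List.flatMap_congr fun i _ => ?_
  refine Eq.trans (List.map_congr_left fun j _ => ?_) (map_finRange_length l _)
  have := N.rel_iff (e i) (e j) (pairEnv n l[i].2 l[j].2) 0 1 2 3
    (by rw [he₂]; simp [pairEnv]) (by rw [he₂]; simp [pairEnv])
    (by rw [he₂]; simp [pairEnv]) (by rw [he₂]; simp [pairEnv])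
  rw [he₁, he₁] at this
  exact Bool.eq_iff_iff.2 ((@decide_eq_true_iff _ (_)).trans this.symm)

end StackProgram

namespace RVC

open StackProgram

/-! ### The programs for the reductions -/

theorem getElem?_flatMap_of_length {α β : Type} {n : ℕ} (f : α → List β)
    (hf : ∀ a, (f a).length = n) : ∀ (l : List α) (i j : ℕ) (hi : i < l.length), j < n →
    (l.flatMap f)[i * n + j]? = (f l[i])[j]?
  | [], i, j, hi, hj => by simp at hi
  | a :: l, 0, j, hi, hj => by
    rw [List.flatMap_cons, List.getElem?_append_left (by rw [hf]; omega)]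
    simp
  | a :: l, i + 1, j, hi, hj => by
    have ih := getElem?_flatMap_of_length f hf l i j (by simpa using hi) hj
    rw [List.flatMap_cons, List.getElem?_append_right (by rw [hf]; nlinarith), hf]
    have : (i + 1) * n + j - n = i * n + j := by
      rw [Nat.succ_mul]; omega
    rw [this, ih]
    rfl

theorem getElem?_relBits {n : ℕ} (r : Fin n → Fin n → Prop) (i j : Fin n) [Decidable (r i j)] :
    (relBits r)[(i : ℕ) * n + j]? = some (decide (r i j)) := by
  rw [relBits, getElem?_flatMap_of_length _ (by simp) _ _ _ (by simp) j.2]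
  simp only [List.getElem_finRange, List.getElem?_map]
  rw [List.getElem?_eq_getElem (by simp)]
  simp

theorem index_lt {n : ℕ} (i j : Fin n) : (i : ℕ) * n + j < n * n := by
  have h₁ := i.2
  have h₂ := j.2
  nlinarith

theorem getD_relBits_append {n : ℕ} (r : Fin n → Fin n → Prop) (l : List Bool) (i j : Fin n) :
    (relBits r ++ l).getD ((i : ℕ) * n + j) false = true ↔ r i j := by
  classical
  rw [List.getD_eq_getElem?_getD,
    List.getElem?_append_left (by rw [relBits_length]; exact index_lt i j), getElem?_relBits]
  simp

theorem getD_append_relBits {n : ℕ} (r s : Fin n → Fin n → Prop) (i j : Fin n) :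
    (relBits r ++ relBits s).getD (n * n + (i : ℕ) * n + j) false = true ↔ s i j := by
  classical
  rw [List.getD_eq_getElem?_getD, List.getElem?_append_right (by rw [relBits_length]; omega),
    relBits_length, show n * n + (i : ℕ) * n + j - n * n = i * n + j by omega, getElem?_relBits]
  simp

/-- The program that adds the set of all pairs to a graph. -/
def allPairsCmd : Cmd :=
  .seq (.each 0 (.emit true)) (.seq (.emit false) (.seq
    (.each 0 (.each 1 (.ite (.bit false 0 1) (.emit true) (.emit false))))
    (.each 0 (.each 1 (.emit true)))))

theorem relBits_eq_flatMap_range {n : ℕ} (r : Fin n → Fin n → Prop) (f : ℕ → ℕ → Bool)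
    (h : ∀ i j : Fin n, f i j = true ↔ r i j) :
    relBits r = (List.range n).flatMap fun i => (List.range n).map fun j => f i j := by
  rw [← List.map_coe_finRange_eq_range, List.flatMap_map, relBits]
  refine List.flatMap_congr fun i _ => ?_
  rw [List.map_map]
  refine List.map_congr_left fun j _ => ?_
  exact Bool.eq_iff_iff.2 ((@decide_eq_true_iff _ (_)).trans (h i j).symm)

theorem polyTimeComputable_allPairs :
    PolyTimeComputable encodeGraph encodePairs fun x => ⟨x.order, x.graph, Set.univ⟩ := by
  refine polyTimeComputable_of_cmd allPairsCmd ?_ (fun x => x.order)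
    (fun x => relBits x.graph.Adj) (fun _ => rfl) fun x => ?_
  · simp [allPairsCmd, Cmd.Good, Test.Good]
  · have h₁ : relBits x.graph.Adj = (List.range x.order).flatMap fun i =>
        (List.range x.order).flatMap fun j =>
          if (relBits x.graph.Adj).getD (0 + i * x.order + j) false then [true] else [false] := by
      refine (relBits_eq_flatMap_range x.graph.Adj (fun i j => (relBits x.graph.Adj ++ []).getD
        (i * x.order + j) false) fun i j => getD_relBits_append _ _ i j).trans ?_
      refine List.flatMap_congr fun i _ => ?_
      rw [List.map_eq_flatMap]
      refine List.flatMap_congr fun j _ => ?_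
      rw [List.append_nil, Nat.zero_add]
      cases (relBits x.graph.Adj).getD (i * x.order + j) false <;> rfl
    have h₂ : relBits (fun i j : Fin x.order => (i, j) ∈ Set.univ) =
        (List.range x.order).flatMap fun _ => (List.range x.order).flatMap fun _ => [true] := by
      refine (relBits_eq_flatMap_range _ (fun _ _ => true) (by simp)).trans ?_
      refine List.flatMap_congr fun i _ => ?_
      rw [List.map_eq_flatMap]
    simp only [encodePairs, allPairsCmd, Cmd.output]
    rw [h₂]
    congr 1
    · rw [← List.map_eq_flatMap, List.map_const', List.length_range]
    · rw [List.singleton_append]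
      refine congrArg (false :: ·) (congrArg (· ++ _) (h₁.trans ?_))
      simp [Test.eval, Function.update]

/-! ### Names for the vertices of `G_k` -/

/-- The expression that says that two vertices have the same name. -/
def sameExp {ι : Type} [DecidableEq ι] (t t' : ι) (x y x' y' : Var) : BExp :=
  if t = t' then .and (.test (.eq x x')) (.test (.eq y y')) else .ff

/-- The expression for `SimpleGraph.fromRel`. -/
def fromRelExp {ι : Type} [DecidableEq ι] (R : ι → ι → Var → Var → Var → Var → BExp) (t t' : ι)
    (x y x' y' : Var) : BExp :=
  .and (.not (sameExp t t' x y x' y')) (.or (R t t' x y x' y') (R t' t x' y' x y))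

theorem good_fromRelExp {ι : Type} [DecidableEq ι]
    {R : ι → ι → Var → Var → Var → Var → BExp} {x y x' y' : Var}
    (h : ∀ t t', (R t t' x y x' y').Good) (h' : ∀ t t', (R t t' x' y' x y).Good) (t t' : ι) :
    (fromRelExp R t t' x y x' y').Good := by
  refine ⟨?_, h t t', h' t' t⟩
  unfold sameExp
  split <;> simp [BExp.Good, Test.Good]

/-- A naming for the graph that belongs to a relation. -/
def namingFromRel {ι : Type} [DecidableEq ι] {n : ℕ} {w : List Bool} {tags : List ι}
    {kind : ι → Kind} {R : ι → ι → Var → Var → Var → Var → BExp} {α : Type} {r : α → α → Prop}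
    (N : Naming n w tags kind R r) :
    Naming n w tags kind (fromRelExp R) (SimpleGraph.fromRel r).Adj where
  tag := N.tag
  nums := N.nums
  inj := N.inj
  mem := N.mem
  surj := N.surj
  rel_iff a b env x y x' y' h₁ h₂ h₃ h₄ := by
    -- `SimpleGraph.fromRel` asks for distinct vertices, and names determine vertices; so it is
    -- enough to compare names.
    have hs : (sameExp (N.tag a) (N.tag b) x y x' y').eval n w env = true ↔ a = b := by
      unfold sameExp
      split
      · rename_i h
        simp only [BExp.eval, Test.eval, h₁, h₂, h₃, h₄, Bool.and_eq_true, decide_eq_true_eq]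
        exact ⟨fun h' => N.inj a b h (Prod.ext h'.1 h'.2), by rintro rfl; simp⟩
      · rename_i h
        simp only [BExp.eval, Bool.false_eq_true, false_iff]
        rintro rfl
        exact h rfl
    rw [SimpleGraph.fromRel_adj, ← N.rel_iff a b env x y x' y' h₁ h₂ h₃ h₄,
      ← N.rel_iff b a env x' y' x y h₃ h₄ h₁ h₂, ne_eq, ← hs]
    simp [fromRelExp, BExp.eval]

/-- A description of the vertices and edges of `lower P k` that does not depend on `P`. -/
structure LowerCode where
  /-- the families of vertices -/
  ι : Type
  [decEq : DecidableEq ι]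
  /-- the list of all families -/
  tags : List ι
  /-- the kinds of the families -/
  kind : ι → Kind
  /-- the edges -/
  adj : ι → ι → Var → Var → Var → Var → BExp
  /-- the edges between a vertex with a name given by the first two variables and the top vertex
  that is given by the third variable -/
  att : ι → Var → Var → Var → BExp
  nodup : tags.Nodup
  good_adj : ∀ t t' x y x' y', (adj t t' x y x' y').Good
  good_att : ∀ t x y z, (att t x y z).Good

attribute [instance] LowerCode.decEq

/-- Names for the vertices below the top layer. -/
structure LowerNaming (L : LowerCode) {n : ℕ} (w : List Bool) (X : Lower (Fin n)) extends
    Naming n w L.tags L.kind L.adj X.graph.Adj where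
  att_iff : ∀ a (i : Fin n) (env : Var → ℕ) (x y z : Var), env x = (nums a).1 → env y = (nums a).2 →
    env z = (i : ℕ) → ((L.att (tag a) x y z).eval n w env = true ↔ X.att i a)

theorem Kind.mem_codes_single {n : ℕ} {w : List Bool} {c : ℕ × ℕ} :
    c ∈ Kind.single.codes n w ↔ c = (0, 0) := by simp [Kind.codes]

theorem Kind.mem_codes_vert {n : ℕ} {w : List Bool} {c : ℕ × ℕ} :
    c ∈ Kind.vert.codes n w ↔ ∃ i : Fin n, c = ((i : ℕ), 0) := by
  simp only [Kind.codes, List.mem_map, List.mem_range]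
  exact ⟨fun ⟨i, hi, h⟩ => ⟨⟨i, hi⟩, h.symm⟩, fun ⟨i, h⟩ => ⟨i, i.2, h.symm⟩⟩

theorem Kind.mem_codes_pair {n : ℕ} (r : Fin n → Fin n → Prop) (P : Set (Fin n × Fin n))
    {c : ℕ × ℕ} :
    c ∈ Kind.pair.codes n (relBits r ++ relBits fun i j => (i, j) ∈ P) ↔
      ∃ p : NonPair P, c = ((p.1.1 : ℕ), (p.1.2 : ℕ)) := by
  have key : ∀ i j : Fin n, isNonPair n (relBits r ++ relBits fun i j => (i, j) ∈ P) i j = true ↔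
      (i, j) ∉ P ∧ (i, j).swap ∉ P := by
    intro i j
    simp only [isNonPair, Bool.and_eq_true, Bool.not_eq_true', ← Bool.not_eq_true,
      getD_append_relBits, Prod.swap_prod_mk]
  simp only [Kind.codes, List.mem_flatMap, List.mem_map, List.mem_filter, List.mem_range]
  constructor
  · rintro ⟨i, hi, j, ⟨hj, h⟩, rfl⟩
    exact ⟨⟨(⟨i, hi⟩, ⟨j, hj⟩), (key ⟨i, hi⟩ ⟨j, hj⟩).1 h⟩, rfl⟩
  · rintro ⟨⟨⟨i, j⟩, h⟩, rfl⟩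
    exact ⟨i, i.2, j, ⟨j.2, (key i j).2 h⟩, rfl⟩

end RVC

/-! ### Programs for `G_2`, `G_3`, the splitting step, and `G_k` -/

namespace RVC

open StackProgram

/-- The families of the vertices of `G_2` below the top layer. -/
inductive EvenTag : Type
  | u | v (α : Bool) | w (α : Bool)
  deriving DecidableEq

/-- The kinds of the families of `G_2`. -/
def EvenTag.kind : EvenTag → Kind
  | u => .single
  | v _ => .vert
  | w _ => .pair

/-- The description of `evenRel`. -/
def EvenTag.rel : EvenTag → EvenTag → Var → Var → Var → Var → BExp
  | u, _, _, _, _, _ => .tt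
  | v _, v _, x, _, x', _ => .test (.eq x x')
  | w _, w _, x, y, x', y' => .and (.test (.eq x x')) (.test (.eq y y'))
  | _, _, _, _, _, _ => .ff

/-- The description of `evenAtt`. -/
def EvenTag.att : EvenTag → Var → Var → Var → BExp
  | u, _, _, _ => .ff
  | v _, x, _, z => .test (.eq z x)
  | w false, x, _, z => .test (.eq z x)
  | w true, _, y, z => .test (.eq z y)

theorem EvenTag.good_rel (t t' : EvenTag) (x y x' y' : Var) : (t.rel t' x y x' y').Good := by
  cases t <;> cases t' <;> simp [EvenTag.rel, BExp.Good, Test.Good]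

/-- The families of the vertices of `G_2` below the top layer. -/
def evenTags : List EvenTag := [.u, .v false, .v true, .w false, .w true]

/-- The description of the lower part of `G_2`. -/
def evenCode : LowerCode where
  ι := EvenTag
  tags := evenTags
  kind := EvenTag.kind
  adj := fromRelExp EvenTag.rel
  att := EvenTag.att
  nodup := by decide
  good_adj t t' x y x' y' := good_fromRelExp (fun _ _ => EvenTag.good_rel ..)
    (fun _ _ => EvenTag.good_rel ..) t t'
  good_att t x y z := by
    rcases t with _ | _ | _ | _ <;> simp [EvenTag.att, BExp.Good, Test.Good]

/-- The input that belongs to a graph and a set of pairs. -/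
noncomputable abbrev inputBits {n : ℕ} (r : Fin n → Fin n → Prop) (P : Set (Fin n × Fin n)) :
    List Bool := relBits r ++ relBits fun i j => (i, j) ∈ P

theorem nonPair_ext {n : ℕ} {P : Set (Fin n × Fin n)} {p q : NonPair P}
    (h₁ : (p.1.1 : ℕ) = q.1.1) (h₂ : (p.1.2 : ℕ) = q.1.2) : p = q :=
  Subtype.ext (Prod.ext (Fin.ext h₁) (Fin.ext h₂))

theorem nonPair_eq_iff {n : ℕ} {P : Set (Fin n × Fin n)} {p q : NonPair P} :
    p = q ↔ (p.1.1 : ℕ) = q.1.1 ∧ (p.1.2 : ℕ) = q.1.2 :=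
  ⟨by rintro rfl; simp, fun h => nonPair_ext h.1 h.2⟩

section

variable {n : ℕ} (r : Fin n → Fin n → Prop) (P : Set (Fin n × Fin n))

/-- Names for the vertices of `G_2` below the top layer. -/
noncomputable def evenNaming' : Naming n (inputBits r P) evenTags EvenTag.kind EvenTag.rel (evenRel P) where
  tag a := match a with
    | .u => EvenTag.u
    | .v _ α => EvenTag.v α
    | .w _ α => EvenTag.w α
  nums a := match a with
    | .u => (0, 0)
    | .v i _ => (i, 0)
    | .w p _ => (p.1.1, p.1.2)
  inj a b h₁ h₂ := by
    cases a <;> cases b <;> simp_all [nonPair_eq_iff, Fin.ext_iff]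
  mem a := by
    rcases a with _ | ⟨i, _ | _⟩ | ⟨p, _ | _⟩ <;> refine ⟨by simp [evenTags], ?_⟩
    · exact Kind.mem_codes_single.2 rfl
    · exact Kind.mem_codes_vert.2 ⟨i, rfl⟩
    · exact Kind.mem_codes_vert.2 ⟨i, rfl⟩
    · exact (Kind.mem_codes_pair r P).2 ⟨p, rfl⟩
    · exact (Kind.mem_codes_pair r P).2 ⟨p, rfl⟩
  surj t _ c hc := by
    rcases t with _ | α | α
    · exact ⟨.u, rfl, (Kind.mem_codes_single.1 hc).symm⟩
    · obtain ⟨i, h⟩ := Kind.mem_codes_vert.1 hc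
      exact ⟨.v i α, rfl, h.symm⟩
    · obtain ⟨p, h⟩ := (Kind.mem_codes_pair r P).1 hc
      exact ⟨.w p α, rfl, h.symm⟩
  rel_iff a b env x y x' y' h₁ h₂ h₃ h₄ := by
    cases a <;> cases b <;>
      simp_all [EvenTag.rel, evenRel, BExp.eval, Test.eval, nonPair_eq_iff, Fin.ext_iff]

/-- Names for the vertices of `G_2` below the top layer. -/
noncomputable def evenNaming : LowerNaming evenCode (inputBits r P)
    ⟨EvenVertex P, SimpleGraph.fromRel (evenRel P), evenAtt P⟩ where
  toNaming := namingFromRel (evenNaming' r P)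
  att_iff a i env x y z h₁ h₂ h₃ := by
    rcases a with _ | ⟨i, _ | _⟩ | ⟨p, _ | _⟩ <;>
      simp_all [evenCode, EvenTag.att, evenAtt, BExp.eval, Test.eval, namingFromRel, evenNaming',
        Fin.ext_iff]

end

/-- The families of the vertices of `G_3` below the top layer. -/
inductive OddTag : Type
  | v0 (α : Bool) | u (α : Bool) | v1 (α : Bool) | w (α : Bool)
  deriving DecidableEq

/-- The kinds of the families of `G_3`. -/
def OddTag.kind : OddTag → Kind
  | v0 _ => .vert
  | u _ => .pair
  | v1 _ => .vert
  | w _ => .pair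

/-- The description of `oddRel`. -/
def OddTag.rel : OddTag → OddTag → Var → Var → Var → Var → BExp
  | v0 _, v0 _, _, _, _, _ => .tt
  | v0 _, u _, _, _, _, _ => .tt
  | u _, u _, _, _, _, _ => .tt
  | v0 _, v1 _, x, _, x', _ => .test (.eq x x')
  | u _, w _, x, y, x', y' => .and (.test (.eq x x')) (.test (.eq y y'))
  | v1 _, v1 _, x, _, x', _ => .test (.eq x x')
  | _, _, _, _, _, _ => .ff

/-- The description of `oddAtt`. -/
def OddTag.att : OddTag → Var → Var → Var → BExp
  | v0 _, _, _, _ => .ff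
  | u _, _, _, _ => .ff
  | v1 _, x, _, z => .test (.eq z x)
  | w false, x, _, z => .test (.eq z x)
  | w true, _, y, z => .test (.eq z y)

theorem OddTag.good_rel (t t' : OddTag) (x y x' y' : Var) : (t.rel t' x y x' y').Good := by
  cases t <;> cases t' <;> simp [OddTag.rel, BExp.Good, Test.Good]

/-- The families of the vertices of `G_3` below the top layer. -/
def oddTags : List OddTag :=
  [.v0 false, .v0 true, .u false, .u true, .v1 false, .v1 true, .w false, .w true]

/-- The description of the lower part of `G_3`. -/
def oddCode : LowerCode where
  ι := OddTag
  tags := oddTags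
  kind := OddTag.kind
  adj := fromRelExp OddTag.rel
  att := OddTag.att
  nodup := by decide
  good_adj t t' x y x' y' := good_fromRelExp (fun _ _ => OddTag.good_rel ..)
    (fun _ _ => OddTag.good_rel ..) t t'
  good_att t x y z := by
    rcases t with _ | _ | _ | _ | _ <;> simp [OddTag.att, BExp.Good, Test.Good]

/-- The edges after the splitting of the top layer. -/
def splitRel (L : LowerCode) : L.ι ⊕ Bool → L.ι ⊕ Bool → Var → Var → Var → Var → BExp
  | .inl t, .inl t', x, y, x', y' => L.adj t t' x y x' y'
  | .inl t, .inr _, x, y, x', _ => L.att t x y x'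
  | .inr _, .inr _, x, _, x', _ => .test (.eq x x')
  | _, _, _, _, _, _ => .ff

theorem good_splitRel (L : LowerCode) (t t' : L.ι ⊕ Bool) (x y x' y' : Var) :
    (splitRel L t t' x y x' y').Good := by
  rcases t with t | t <;> rcases t' with t' | t'
  · exact L.good_adj ..
  · exact L.good_att ..
  · trivial
  · trivial

/-- The families after the splitting of the top layer. -/
def splitTags (L : LowerCode) : List (L.ι ⊕ Bool) :=
  L.tags.map Sum.inl ++ [Sum.inr false, Sum.inr true]

/-- The edges to the new top layer. -/
def splitAtt (L : LowerCode) : L.ι ⊕ Bool → Var → Var → Var → BExp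
  | .inl _, _, _, _ => .ff
  | .inr _, x, _, z => .test (.eq z x)

/-- The description of `Lower.split`. -/
def LowerCode.split (L : LowerCode) : LowerCode where
  ι := L.ι ⊕ Bool
  tags := splitTags L
  kind := Sum.elim L.kind fun _ => .vert
  adj := fromRelExp (splitRel L)
  att := splitAtt L
  nodup := by
    refine List.Nodup.append (L.nodup.map Sum.inl_injective) (by simp) ?_
    simp [List.disjoint_left]
  good_adj t t' x y x' y' := good_fromRelExp (fun _ _ => good_splitRel ..)
    (fun _ _ => good_splitRel ..) t t'
  good_att t x y z := by rcases t with t | t <;> trivial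

/-- The description of `lower P k`. -/
def lowerCode : ℕ → LowerCode
  | 0 | 1 | 2 => evenCode
  | 3 => oddCode
  | k + 4 => (lowerCode (k + 2)).split

/-- The edges of the whole graph. -/
def layeredRel (L : LowerCode) : L.ι ⊕ Unit → L.ι ⊕ Unit → Var → Var → Var → Var → BExp
  | .inl t, .inl t', x, y, x', y' => L.adj t t' x y x' y'
  | .inl t, .inr _, x, y, x', _ => L.att t x y x'
  | .inr _, .inr _, x, _, x', _ => .test (.bit false x x')
  | _, _, _, _, _, _ => .ff

/-- The program that writes the encoding of `G_k`. -/
def layeredCmd (k : ℕ) : Cmd :=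
  graphCmd ((lowerCode k).tags.map Sum.inl ++ [Sum.inr ()])
    (Sum.elim (lowerCode k).kind fun _ => .vert) (fromRelExp (layeredRel (lowerCode k)))

/-- Matrix lookups in the edge relation occur only for edges within the top layer. Their row
variable is `0` or, after the symmetrization by `fromRelExp`, `2`, and never the reserved `4`. -/
theorem good_layeredCmd (k : ℕ) : (layeredCmd k).Good {4, 5} := by
  have key : ∀ (L : LowerCode) (t t' : L.ι ⊕ Unit) (x y x' y' : Var), x ≠ 4 →
      (layeredRel L t t' x y x' y').Good := by
    intro L t t' x y x' y' h
    rcases t with t | t <;> rcases t' with t' | t'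
    · exact L.good_adj ..
    · exact L.good_att ..
    · trivial
    · exact h
  exact good_graphCmd _ _ _ fun t t' => good_fromRelExp
    (fun _ _ => key _ _ _ _ _ _ _ (by decide)) (fun _ _ => key _ _ _ _ _ _ _ (by decide)) t t'

section

variable {n : ℕ} (r : Fin n → Fin n → Prop) (P : Set (Fin n × Fin n))

/-- Names for the vertices of `G_3` below the top layer. -/
noncomputable def oddNaming' : Naming n (inputBits r P) oddTags OddTag.kind OddTag.rel (oddRel P) where
  tag a := match a with
    | .v0 _ α => OddTag.v0 α
    | .u _ α => OddTag.u α
    | .v1 _ α => OddTag.v1 α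
    | .w _ α => OddTag.w α
  nums a := match a with
    | .v0 i _ => (i, 0)
    | .u p _ => (p.1.1, p.1.2)
    | .v1 i _ => (i, 0)
    | .w p _ => (p.1.1, p.1.2)
  inj a b h₁ h₂ := by
    cases a <;> cases b <;> simp_all [nonPair_eq_iff, Fin.ext_iff]
  mem a := by
    rcases a with ⟨i, _ | _⟩ | ⟨p, _ | _⟩ | ⟨i, _ | _⟩ | ⟨p, _ | _⟩ <;>
      refine ⟨by simp [oddTags], ?_⟩
    all_goals first
      | exact Kind.mem_codes_vert.2 ⟨i, rfl⟩
      | exact (Kind.mem_codes_pair r P).2 ⟨p, rfl⟩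
  surj t _ c hc := by
    rcases t with α | α | α | α
    · obtain ⟨i, h⟩ := Kind.mem_codes_vert.1 hc
      exact ⟨.v0 i α, rfl, h.symm⟩
    · obtain ⟨p, h⟩ := (Kind.mem_codes_pair r P).1 hc
      exact ⟨.u p α, rfl, h.symm⟩
    · obtain ⟨i, h⟩ := Kind.mem_codes_vert.1 hc
      exact ⟨.v1 i α, rfl, h.symm⟩
    · obtain ⟨p, h⟩ := (Kind.mem_codes_pair r P).1 hc
      exact ⟨.w p α, rfl, h.symm⟩
  rel_iff a b env x y x' y' h₁ h₂ h₃ h₄ := by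
    cases a <;> cases b <;>
      simp_all [OddTag.rel, oddRel, BExp.eval, Test.eval, nonPair_eq_iff, Fin.ext_iff]

/-- Names for the vertices of `G_3` below the top layer. -/
noncomputable def oddNaming : LowerNaming oddCode (inputBits r P)
    ⟨OddVertex P, SimpleGraph.fromRel (oddRel P), oddAtt P⟩ where
  toNaming := namingFromRel (oddNaming' r P)
  att_iff a i env x y z h₁ h₂ h₃ := by
    rcases a with ⟨i, _ | _⟩ | ⟨p, _ | _⟩ | ⟨i, _ | _⟩ | ⟨p, _ | _⟩ <;>
      simp_all [oddCode, OddTag.att, oddAtt, BExp.eval, Test.eval, namingFromRel, oddNaming',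
        Fin.ext_iff]

variable {P} in
/-- Names for the vertices after the splitting of the top layer. -/
noncomputable def splitNaming {L : LowerCode} {w : List Bool} {X : Lower (Fin n)}
    (N : LowerNaming L w X) : LowerNaming L.split w X.split where
  toNaming := namingFromRel (ι := L.ι ⊕ Bool) (tags := splitTags L)
      (kind := Sum.elim L.kind fun _ => .vert) (R := splitRel L) (α := X.carrier ⊕ Fin n × Bool) {
    tag := Sum.elim (fun a => Sum.inl (N.tag a)) fun q => Sum.inr q.2
    nums := Sum.elim N.nums fun q => (q.1, 0)
    inj := by
      rintro (a | ⟨i, α⟩) (b | ⟨j, β⟩) h₁ h₂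
      · exact congrArg Sum.inl (N.inj a b (Sum.inl_injective h₁) h₂)
      · cases h₁
      · cases h₁
      · simp_all [Fin.ext_iff]
    mem := by
      rintro (a | ⟨i, α⟩)
      · exact ⟨by simpa [splitTags] using (N.mem a).1, (N.mem a).2⟩
      · refine ⟨?_, Kind.mem_codes_vert.2 ⟨i, rfl⟩⟩
        cases α <;> simp [splitTags]
    surj := by
      rintro (t | α) ht c hc
      · obtain ⟨a, h₁, h₂⟩ := N.surj t (by simpa [splitTags] using ht) c hc
        exact ⟨.inl a, congrArg Sum.inl h₁, h₂⟩
      · obtain ⟨i, h⟩ := Kind.mem_codes_vert.1 hc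
        exact ⟨.inr (i, α), rfl, h.symm⟩
    rel_iff := by
      rintro (a | ⟨i, α⟩) (b | ⟨j, β⟩) env x y x' y' h₁ h₂ h₃ h₄
      · exact N.rel_iff a b env x y x' y' h₁ h₂ h₃ h₄
      · exact N.att_iff a j env x y x' h₁ h₂ h₃
      · simp [splitRel, BExp.eval]
      · simp_all [splitRel, BExp.eval, Test.eval, Fin.ext_iff] }
  att_iff := by
    rintro (a | ⟨i, α⟩) j env x y z h₁ h₂ h₃
    · exact iff_of_false Bool.false_ne_true id
    · change (BExp.test (.eq z x)).eval n w env = true ↔ j = i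
      have h₁ : env x = (i : ℕ) := h₁
      simp [BExp.eval, Test.eval, h₁, h₃, Fin.ext_iff]

/-- Names for the vertices of `G_k` below the top layer. -/
noncomputable def lowerNaming : (k : ℕ) → LowerNaming (lowerCode k) (inputBits r P) (lower P k)
  | 0 | 1 | 2 => evenNaming r P
  | 3 => oddNaming r P
  | k + 4 => splitNaming (lowerNaming (k + 2))

/-- Names for the vertices of `G_k`. -/
noncomputable def layeredNaming (G : SimpleGraph (Fin n)) (k : ℕ) :
    Naming n (inputBits G.Adj P) ((lowerCode k).tags.map Sum.inl ++ [Sum.inr ()])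
      (Sum.elim (lowerCode k).kind fun _ => .vert) (fromRelExp (layeredRel (lowerCode k)))
      (layeredGraph G P k).Adj :=
  namingFromRel {
    tag := Sum.elim (fun a => Sum.inl ((lowerNaming G.Adj P k).tag a)) fun _ => Sum.inr ()
    nums := Sum.elim (lowerNaming G.Adj P k).nums fun i => (i, 0)
    inj := by
      rintro (a | i) (b | j) h₁ h₂
      · exact congrArg Sum.inl ((lowerNaming G.Adj P k).inj a b (Sum.inl_injective h₁) h₂)
      · cases h₁
      · cases h₁
      · simp_all [Fin.ext_iff]
    mem := by
      rintro (a | i)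
      · have := (lowerNaming G.Adj P k).mem a
        exact ⟨by simpa using this.1, this.2⟩
      · exact ⟨by simp, Kind.mem_codes_vert.2 ⟨i, rfl⟩⟩
    surj := by
      rintro (t | α) ht c hc
      · obtain ⟨a, h₁, h₂⟩ := (lowerNaming G.Adj P k).surj t (by simpa using ht) c hc
        exact ⟨.inl a, congrArg Sum.inl h₁, h₂⟩
      · obtain ⟨i, h⟩ := Kind.mem_codes_vert.1 hc
        exact ⟨.inr i, rfl, h.symm⟩
    rel_iff := by
      rintro (a | i) (b | j) env x y x' y' h₁ h₂ h₃ h₄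
      · exact (lowerNaming G.Adj P k).rel_iff a b env x y x' y' h₁ h₂ h₃ h₄
      · exact (lowerNaming G.Adj P k).att_iff a j env x y x' h₁ h₂ h₃
      · simp [layeredRel, BExp.eval]
      · simp only [Sum.elim_inr] at h₁ h₃
        simp only [Sum.elim_inr, layeredRel, BExp.eval, Test.eval, h₁, h₃]
        rw [← getD_relBits_append G.Adj (relBits fun i j => (i, j) ∈ P) i j]
        simp [inputBits] }

end

/-- A polynomial-time computable function maps each graph with a set of pairs to a graph that is
isomorphic to `G_k`. -/
theorem exists_polyTimeComputable_layeredGraph (k : ℕ) :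
    ∃ f : PairInstance → GraphInstance, PolyTimeComputable encodePairs encodeGraph f ∧
      ∀ x, Nonempty ((f x).graph ≃g layeredGraph x.graph x.pairs k) := by
  have h : ∀ x : PairInstance, ∃ y : GraphInstance,
      encodeGraph y = (layeredCmd k).output x.order (inputBits x.graph.Adj x.pairs)
        (initialVal x.order) ∧ Nonempty (y.graph ≃g layeredGraph x.graph x.pairs k) := by
    intro x
    obtain ⟨m, e, he⟩ := (layeredNaming x.pairs x.graph k).exists_equiv (by
      refine List.Nodup.append ((lowerCode k).nodup.map Sum.inl_injective) (by simp) ?_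
      simp)
    exact ⟨_, he, ⟨SimpleGraph.Iso.comap e _⟩⟩
  choose f hf₁ hf₂ using h
  exact ⟨f, polyTimeComputable_of_cmd (layeredCmd k) (good_layeredCmd k) (fun x => x.order)
    (fun x => inputBits x.graph.Adj x.pairs) (fun _ => rfl) hf₁, hf₂⟩

end RVC

namespace RVC

/-! ### Rainbow paths from sequences of vertices -/

/-- The vertices of the list, one after the other, lead from a start, whose neighbours satisfy `s`,
to an end, whose neighbours satisfy `t`; if the list is empty, then `d` holds. -/
def Thread {α : Type} (R : α → α → Prop) (t : α → Prop) : (α → Prop) → Prop → List α → Prop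
  | _, d, [] => d
  | s, _, x :: l => s x ∧ Thread R t (R x) (t x) l

/-- This carries paths from one level to the next: the ends are known only through predicates, so a
top vertex of the old graph may be replaced by either of its two copies. -/
theorem Thread.map {α β : Type} {R : α → α → Prop} {t : α → Prop} {R' : β → β → Prop}
    {t' : β → Prop} (f : α → β) (hR : ∀ x y, R x y → R' (f x) (f y)) (ht : ∀ x, t x → t' (f x)) :
    ∀ {s : α → Prop} {d : Prop} {s' : β → Prop} {d' : Prop} {l : List α}, Thread R t s d l →
      (∀ x, s x → s' (f x)) → (d → d') → Thread R' t' s' d' (l.map f)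
  | _, _, _, _, [], h, _, hd => hd h
  | _, _, _, _, _ :: _, h, hs, _ => ⟨hs _ h.1, h.2.map f hR ht (hR _) (ht _)⟩

/-- The end `y` becomes an inner vertex and `t` describes the new end. The new list is nonempty, so
`d'` is arbitrary. -/
theorem Thread.append {α : Type} {G : SimpleGraph α} {t : α → Prop} (y : α) (hy : t y)
    {d' : Prop} : ∀ {s : α → Prop} {l : List α}, Thread G.Adj (G.Adj y) s (s y) l →
      Thread G.Adj t s d' (l ++ [y])
  | _, [], h => ⟨h, hy⟩
  | _, x :: _, h => ⟨h.1, Thread.append y hy (by rw [G.adj_comm x y]; exact h.2)⟩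

theorem Thread.reverse {α : Type} {G : SimpleGraph α} {t : α → Prop} :
    ∀ {s : α → Prop} {d : Prop} {l : List α}, Thread G.Adj t s d l →
      Thread G.Adj s t d l.reverse
  | _, _, [], h => h
  | _, _, x :: _, h => by
    rw [List.reverse_cons]
    exact Thread.append x h.1 h.2.reverse

theorem Thread.exists_walk {V : Type} {G : SimpleGraph V} {b : V} : ∀ {a : V} {l : List V},
    Thread G.Adj (G.Adj b) (G.Adj a) (G.Adj a b) l → ∃ p : G.Walk a b, p.support = a :: (l ++ [b])
  | _, [], h => ⟨.cons h .nil, rfl⟩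
  | _, x :: _, h => by
    have h₂ := h.2
    rw [G.adj_comm b x] at h₂
    obtain ⟨p, hp⟩ := h₂.exists_walk
    exact ⟨.cons h.1 p, by rw [SimpleGraph.Walk.support_cons, hp]; rfl⟩

theorem support_eq_of_ne {V : Type} {G : SimpleGraph V} {a b : V} (p : G.Walk a b) (hab : a ≠ b) :
    p.support = a :: (p.support.tail.dropLast ++ [b]) := by
  have h : p.support.tail ≠ [] := by
    cases p with
    | nil => exact absurd rfl hab
    | cons h q => simp
  have hb : p.support.tail.getLast h = b := by
    rw [List.getLast_tail]
    exact p.getLast_support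
  conv_lhs => rw [← p.cons_tail_support, ← List.dropLast_append_getLast h, hb]

theorem RainbowPair.refl {V C : Type} (G : SimpleGraph V) (c : V → C) (a : V) :
    RainbowPair G c a a := ⟨.nil, by simp, by simp⟩

theorem RainbowPair.symm {V C : Type} {G : SimpleGraph V} {c : V → C} {a b : V}
    (h : RainbowPair G c a b) : RainbowPair G c b a := by
  obtain ⟨p, hp, hc⟩ := h
  refine ⟨p.reverse, hp.reverse, ?_⟩
  rw [SimpleGraph.Walk.support_reverse, List.tail_reverse, List.dropLast_reverse,
    List.map_reverse, List.nodup_reverse, List.tail_dropLast]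
  exact hc

theorem RainbowPair.map {V W C : Type} {G : SimpleGraph V} {H : SimpleGraph W} {c : V → C}
    {c' : W → C} {a b : V} (φ : G ↪g H) (hc : ∀ x, c' (φ x) = c x) (h : RainbowPair G c a b) :
    RainbowPair H c' (φ a) (φ b) := by
  obtain ⟨p, hp, hpc⟩ := h
  refine ⟨p.map φ.toHom, hp.map φ.injective, ?_⟩
  rw [SimpleGraph.Walk.support_map, ← List.map_tail, ← List.map_dropLast, List.map_map]
  convert hpc using 2
  exact funext hc

/-- Distinct colours make the listed vertices distinct from each other, but the list may still
contain `a` or `b`. Shortcutting the walk to a path repairs this and can only drop inner vertices,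
so the colours stay distinct. Thus the constructions below need no case distinctions for
coincidences with the ends. -/
theorem Thread.rainbowPair {V C : Type} {G : SimpleGraph V} {c : V → C} {a b : V} {l : List V}
    (h : Thread G.Adj (G.Adj b) (G.Adj a) (G.Adj a b) l) (hc : (l.map c).Nodup) :
    RainbowPair G c a b := by
  classical
  by_cases hab : a = b
  · subst hab
    exact RainbowPair.refl G c a
  obtain ⟨p, hp⟩ := h.exists_walk
  have hq := p.bypass_isPath
  refine ⟨p.bypass, hq, ?_⟩
  have hs := support_eq_of_ne p.bypass hab
  have hn := hq.support_nodup
  rw [hs, List.nodup_cons, List.nodup_append] at hn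
  refine hn.2.1.map_on fun x hx y hy hxy => ?_
  have hl : ∀ z ∈ p.bypass.support.tail.dropLast, z ∈ l := by
    intro z hz
    have h₁ : z ∈ p.bypass.support := by rw [hs]; simp [hz]
    have h₂ := p.support_bypass_subset_support h₁
    rw [hp] at h₂
    have h₃ : z ≠ a := by rintro rfl; exact hn.1 (by simp [hz])
    have h₄ : z ≠ b := hn.2.2.2 z hz b (by simp)
    simpa [h₃, h₄] using h₂
  exact List.inj_on_of_nodup_map hc (hl x hx) (hl y hy) hxy

/-! ### The colouring of `G_k` -/

/-- The colouring `col` of the vertices below the top layer of `G_(m + 2)` provides rainbow paths.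
The colour `s` is used for the root of `G_2` and for half of the bottom layer of `G_3`, where two
paths from the same layer meet. -/
structure LowerColouring {V α : Type} (P : Set (V × V)) (G : SimpleGraph α) (att : V → α → Prop)
    (m s : ℕ) (col : α → ℕ) : Prop where
  bound : ∀ x, col x < m + 2 ∨ col x = s
  lower : m ≤ s → ∀ x y, x ≠ y → ∃ l, Thread G.Adj (G.Adj y) (G.Adj x) (G.Adj x y) l ∧
    (l.map col).Nodup ∧ ∀ z ∈ l, col z < m ∨ col z = s
  mixed : m ≤ s → ∀ i y (ε : Bool), s ≠ m + ε.toNat → ∃ l,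
    Thread G.Adj (G.Adj y) (att i) (att i y) l ∧ (l.map col).Nodup ∧
      ∀ z ∈ l, col z < m ∨ col z = s ∨ col z = m + ε.toNat
  top : m + 2 ≤ s → ∀ i j, i ≠ j → ∃ l, Thread G.Adj (att j) (att i) False l ∧
    (l.map col).Nodup ∧ ∀ z ∈ l, col z < m + 2 ∨ col z = s
  nonPair : ∀ i j, (i, j) ∉ P → (j, i) ∉ P → ∃ l, Thread G.Adj (att j) (att i) False l ∧
    (l.map col).Nodup ∧ ∀ z ∈ l, col z < m + 2

variable {V α : Type}

/-- The relation between the lower parts of `G_k` and `G_(k + 2)`. -/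
structure IsSplit (G : SimpleGraph α) (att : V → α → Prop) (H : SimpleGraph (α ⊕ V × Bool))
    (att' : V → α ⊕ V × Bool → Prop) : Prop where
  inl_inl : ∀ x y, H.Adj (.inl x) (.inl y) ↔ G.Adj x y
  inl_inr : ∀ x q, H.Adj (.inl x) (.inr q) ↔ att q.1 x
  inr_inr : ∀ q q', H.Adj (.inr q) (.inr q') ↔ q ≠ q' ∧ q.1 = q'.1
  att_inl : ∀ i x, ¬att' i (.inl x)
  att_inr : ∀ i q, att' i (.inr q) ↔ i = q.1

theorem Lower.isSplit_split (X : Lower V) :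
    IsSplit X.graph X.att X.split.graph X.split.att where
  inl_inl x y := by
    simp only [Lower.split, SimpleGraph.fromRel_adj, ne_eq, Sum.inl.injEq]
    constructor
    · rintro ⟨_, h | h⟩
      exacts [h, h.symm]
    · exact fun h => ⟨h.ne, .inl h⟩
  inl_inr x q := by simp [Lower.split, SimpleGraph.fromRel_adj]
  inr_inr q q' := by simp [Lower.split, SimpleGraph.fromRel_adj, eq_comm]
  att_inl i x := id
  att_inr i q := Iff.rfl

/-- An old top vertex becomes two lower vertices with the new colours `m + 2` and `m + 3`. Old paths
between them, or from them to lower vertices, avoid these colours as long as `m + 2 ≤ s`, and serve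
as lower paths. Paths from a new top vertex prepend one copy in the colour of choice. Paths between
two new top vertices prepend the first copy at one end and append the second copy at the other, so
both new colours are used once. -/
theorem LowerColouring.split {P : Set (V × V)} {G : SimpleGraph α} {att : V → α → Prop} {m s : ℕ}
    {col : α → ℕ} (h : LowerColouring P G att m s col) {H : SimpleGraph (α ⊕ V × Bool)}
    {att' : V → α ⊕ V × Bool → Prop} (hH : IsSplit G att H att') :
    LowerColouring P H att' (m + 2) s (Sum.elim col fun q => m + 2 + q.2.toNat) := by
  set col' : α ⊕ V × Bool → ℕ := Sum.elim col fun q => m + 2 + q.2.toNat with hcol'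
  have hnd : ∀ l : List α, (l.map col).Nodup → ((l.map Sum.inl).map col').Nodup := by
    intro l hl
    rwa [List.map_map]
  have hmem : ∀ {l : List α} {Q : ℕ → Prop}, (∀ z ∈ l, Q (col z)) →
      ∀ z ∈ l.map (Sum.inl : _ → α ⊕ V × Bool), Q (col' z) := by
    intro l Q hl z hz
    obtain ⟨y, hy, rfl⟩ := List.mem_map.1 hz
    exact hl y hy
  have hinr : ∀ q, col' (.inr q) = m + 2 + q.2.toNat := fun q => rfl
  have hadj : ∀ x y, G.Adj x y → H.Adj (.inl x) (.inl y) := fun x y => (hH.inl_inl x y).2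
  have hatt : ∀ (q : V × Bool) x, att q.1 x → H.Adj (.inr q) (.inl x) :=
    fun q x h => ((hH.inl_inr x q).2 h).symm
  refine ⟨?_, ?_, ?_, ?_, ?_⟩
  · rintro (x | q)
    · have := h.bound x
      simp only [hcol', Sum.elim_inl]
      omega
    · have := q.2.toNat_le
      rw [hinr]
      omega
  -- A lower path may now use all colours below `m + 2`, so either value of `ε` would do here.
  · have key : ∀ (x : α) (q : V × Bool), m + 2 ≤ s → ∃ l,
        Thread H.Adj (H.Adj (.inl x)) (H.Adj (.inr q)) (H.Adj (.inr q) (.inl x)) l ∧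
          (l.map col').Nodup ∧ ∀ z ∈ l, col' z < m + 2 ∨ col' z = s := by
      intro x q hs
      obtain ⟨l, h₁, h₂, h₃⟩ := h.mixed (by omega) q.1 x true (by simp; omega)
      refine ⟨l.map Sum.inl, h₁.map _ hadj (hadj x) (hatt q) (hatt q x), hnd l h₂,
        hmem (Q := fun c => c < m + 2 ∨ c = s) fun z hz => ?_⟩
      have := h₃ z hz
      simp at this
      omega
    rintro hs (x | q) (y | q') hxy
    · obtain ⟨l, h₁, h₂, h₃⟩ := h.lower (by omega) x y (by rintro rfl; exact hxy rfl)
      refine ⟨l.map Sum.inl, h₁.map _ hadj (hadj y) (hadj x) (hadj x y), hnd l h₂,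
        hmem (Q := fun c => c < m + 2 ∨ c = s) fun z hz => ?_⟩
      have := h₃ z hz
      omega
    · obtain ⟨l, h₁, h₂, h₃⟩ := key x q' hs
      refine ⟨l.reverse, ?_, ?_, fun z hz => h₃ z (List.mem_reverse.1 hz)⟩
      · rw [H.adj_comm]
        exact h₁.reverse
      · rwa [List.map_reverse, List.nodup_reverse]
    · exact key y q hs
    · by_cases hq : q.1 = q'.1
      · exact ⟨[], (hH.inr_inr q q').2 ⟨fun h => hxy (congrArg _ h), hq⟩, by simp, by simp⟩
      · obtain ⟨l, h₁, h₂, h₃⟩ := h.top hs q.1 q'.1 hq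
        exact ⟨l.map Sum.inl, h₁.map _ hadj (hatt q') (hatt q) False.elim, hnd l h₂,
          hmem (Q := fun c => c < m + 2 ∨ c = s) h₃⟩
  -- The prepended copy has a colour that differs from `s` by assumption and exceeds all others on
  -- the old path.
  · have hcons : ∀ (i : V) (ε : Bool) (l : List α), s ≠ m + 2 + ε.toNat →
        (∀ z ∈ l, col z < m + 2 ∨ col z = s) → (l.map col).Nodup →
        ((Sum.inr (i, ε) :: l.map Sum.inl).map col').Nodup ∧
          ∀ z ∈ Sum.inr (i, ε) :: l.map Sum.inl,
            col' z < m + 2 ∨ col' z = s ∨ col' z = m + 2 + ε.toNat := by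
      intro i ε l hs hl hn
      have hl' := hmem (Q := fun c => c < m + 2 ∨ c = s) hl
      refine ⟨?_, ?_⟩
      · rw [List.map_cons, List.nodup_cons]
        refine ⟨fun hmem => ?_, hnd l hn⟩
        obtain ⟨z, hz, hzc⟩ := List.mem_map.1 hmem
        have := hl' z hz
        rw [hinr] at hzc
        dsimp only at hzc
        omega
      · intro z hz
        rcases List.mem_cons.1 hz with rfl | hz
        · exact .inr (.inr (hinr _))
        · exact (hl' z hz).imp_right .inl
    rintro hs i (y | q) ε hε
    · obtain ⟨l, h₁, h₂, h₃⟩ := h.mixed (by omega) i y true (by simp; omega)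
      obtain ⟨h₄, h₅⟩ := hcons i ε l hε (fun z hz => by
        have := h₃ z hz
        simp at this
        omega) h₂
      refine ⟨.inr (i, ε) :: l.map .inl, ⟨(hH.att_inr _ _).2 rfl, ?_⟩, h₄, h₅⟩
      exact h₁.map _ hadj (hadj y) (hatt (i, ε)) fun h => (hatt (i, ε) y h).symm
    · by_cases hq : i = q.1
      · exact ⟨[], (hH.att_inr _ _).2 hq, by simp, by simp⟩
      · obtain ⟨l, h₁, h₂, h₃⟩ := h.top hs i q.1 hq
        obtain ⟨h₄, h₅⟩ := hcons i ε l hε h₃ h₂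
        refine ⟨.inr (i, ε) :: l.map .inl, ⟨(hH.att_inr _ _).2 rfl, ?_⟩, h₄, h₅⟩
        exact h₁.map _ hadj (hatt q) (hatt (i, ε)) False.elim
  all_goals
    -- The predicate `Q` on the old colours lets one construction serve for both remaining fields:
    -- with the colour `s` for `top`, without it for `nonPair`.
    have hends : ∀ (i j : V) (l : List α) (Q : ℕ → Prop), Thread G.Adj (att j) (att i) False l →
        (l.map col).Nodup → (∀ z ∈ l, Q (col z)) → (∀ c, Q c → c < m + 2 ∨ m + 4 ≤ c) →
        Thread H.Adj (att' j) (att' i) False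
          (Sum.inr (i, false) :: (l.map Sum.inl ++ [Sum.inr (j, true)])) ∧
        ((Sum.inr (i, false) :: (l.map Sum.inl ++ [Sum.inr (j, true)])).map col').Nodup ∧
        ∀ z ∈ Sum.inr (i, false) :: (l.map Sum.inl ++ [Sum.inr (j, true)]),
          Q (col' z) ∨ col' z = m + 2 ∨ col' z = m + 3 := by
      intro i j l Q h₁ h₂ h₃ hQ
      have h₄ := hmem h₃
      refine ⟨⟨(hH.att_inr _ _).2 rfl,
        Thread.append (Sum.inr (j, true)) ((hH.att_inr j (j, true)).2 rfl) ?_⟩, ?_, ?_⟩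
      · exact h₁.map _ hadj (hatt (j, true)) (hatt (i, false)) False.elim
      · rw [List.map_cons, List.map_append, List.nodup_cons, List.nodup_append]
        refine ⟨?_, hnd l h₂, by simp, ?_⟩
        · intro hz
          rcases List.mem_append.1 hz with hz | hz
          · obtain ⟨z, hz, hzc⟩ := List.mem_map.1 hz
            have := hQ _ (h₄ z hz)
            rw [hzc, hinr] at this
            simp at this
          · simp [hinr] at hz
        · rintro c hc c' hc' rfl
          obtain ⟨z, hz, rfl⟩ := List.mem_map.1 hc
          have := hQ _ (h₄ z hz)
          simp [hinr] at hc'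
          omega
      · intro z hz
        rcases List.mem_cons.1 hz with rfl | hz
        · exact .inr (.inl (hinr _))
        · rcases List.mem_append.1 hz with hz | hz
          · exact .inl (h₄ z hz)
          · rw [List.mem_singleton.1 hz]
            exact .inr (.inr (hinr _))
  · intro hs i j hij
    obtain ⟨l, h₁, h₂, h₃⟩ := h.top (by omega) i j hij
    obtain ⟨h₄, h₅, h₆⟩ := hends i j l (fun c => c < m + 2 ∨ c = s) h₁ h₂ h₃ (by omega)
    refine ⟨_, h₄, h₅, fun z hz => ?_⟩
    have := h₆ z hz
    omega
  · intro i j hi hj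
    obtain ⟨l, h₁, h₂, h₃⟩ := h.nonPair i j hi hj
    obtain ⟨h₄, h₅, h₆⟩ := hends i j l (fun c => c < m + 2) h₁ h₂ h₃ fun c hc => .inl hc
    refine ⟨_, h₄, h₅, fun z hz => ?_⟩
    have := h₆ z hz
    omega

end RVC

/-! ### The colourings of `G_2` and `G_3` -/

namespace RVC

variable {V : Type} (P : Set (V × V))

/-- The colouring of the lower part of `G_2`. -/
def evenColour (s : ℕ) : EvenVertex P → ℕ
  | .u => s
  | .v _ ε => ε.toNat
  | .w _ ε => ε.toNat

/-- All paths run through the centre `u` of colour `s`, except those for pairs outside `P`, which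
use the edge between the two vertices `w` and avoid `s`. -/
theorem evenColour_lowerColouring (s : ℕ) :
    LowerColouring P (SimpleGraph.fromRel (evenRel P)) (evenAtt P) 0 s (evenColour P s) := by
  have hu : ∀ x : EvenVertex P, x ≠ .u → (SimpleGraph.fromRel (evenRel P)).Adj x .u := by
    intro x hx
    simp [SimpleGraph.fromRel_adj, hx, evenRel]
  have hv : ∀ i ε, (SimpleGraph.fromRel (evenRel P)).Adj (.v i ε) .u := fun i ε => hu _ (by simp)
  refine ⟨?_, ?_, ?_, ?_, ?_⟩
  · rintro (_ | ⟨i, ε⟩ | ⟨p, ε⟩)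
    · exact .inr rfl
    all_goals cases ε <;> simp [evenColour]
  · intro _ x y hxy
    by_cases hx : x = .u
    · subst hx
      exact ⟨[], (hu y hxy.symm).symm, by simp, by simp⟩
    by_cases hy : y = .u
    · subst hy
      exact ⟨[], hu x hx, by simp, by simp⟩
    exact ⟨[.u], ⟨hu x hx, hu y hy⟩, by simp, by simp [evenColour]⟩
  · intro _ i y ε hs
    by_cases hy : y = .u
    · subst hy
      exact ⟨[.v i ε], ⟨rfl, (hv i ε).symm⟩, by simp, by simp [evenColour]⟩
    · refine ⟨[.v i ε, .u], ⟨rfl, hv i ε, hu y hy⟩, ?_, by simp [evenColour]⟩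
      simpa [evenColour] using fun h => hs (by omega)
  · intro hs i j _
    refine ⟨[.v i false, .u, .v j true], ⟨rfl, hv i false, (hv j true).symm, rfl⟩, ?_, ?_⟩
    · simp [evenColour]
      omega
    · simp [evenColour]
  · intro i j hi hj
    refine ⟨[.w ⟨(i, j), hi, hj⟩ false, .w ⟨(i, j), hi, hj⟩ true], ⟨rfl, ?_, rfl⟩, ?_, ?_⟩
    · exact (SimpleGraph.fromRel_adj ..).2 ⟨nofun, .inl rfl⟩
    · simp [evenColour]
    · simp [evenColour]

/-- The colouring of the lower part of `G_3`. -/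
def oddColour (s : ℕ) : OddVertex P → ℕ
  | .v0 _ ε => bif ε then 0 else s
  | .u _ ε => bif ε then 0 else s
  | .v1 _ ε => 1 + ε.toNat
  | .w _ ε => 1 + ε.toNat

variable {P}

/-- The vertices in the bottom layer of `G_3`. -/
def OddVertex.isBottom : OddVertex P → Bool
  | .v0 _ _ => true
  | .u _ _ => true
  | .v1 _ _ => false
  | .w _ _ => false

/-- The superscript. -/
def OddVertex.sup : OddVertex P → Bool
  | .v0 _ ε => ε
  | .u _ ε => ε
  | .v1 _ ε => ε
  | .w _ ε => ε

/-- The vertex in the bottom layer with the same index and the given superscript. -/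
def OddVertex.root : OddVertex P → Bool → OddVertex P
  | .v0 i _, ε => .v0 i ε
  | .u p _, ε => .u p ε
  | .v1 i _, ε => .v0 i ε
  | .w p _, ε => .u p ε

theorem OddVertex.isBottom_root (x : OddVertex P) (ε : Bool) : (x.root ε).isBottom = true := by
  cases x <;> rfl

theorem OddVertex.sup_root (x : OddVertex P) (ε : Bool) : (x.root ε).sup = ε := by
  cases x <;> rfl

theorem OddVertex.adj_of_isBottom {x y : OddVertex P} (hx : x.isBottom = true)
    (hy : y.isBottom = true) (hxy : x ≠ y) : (SimpleGraph.fromRel (oddRel P)).Adj x y := by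
  rw [SimpleGraph.fromRel_adj]
  refine ⟨hxy, ?_⟩
  cases x <;> cases y <;> simp_all [OddVertex.isBottom, oddRel]

theorem OddVertex.adj_root {x : OddVertex P} (hx : x.isBottom = false) (ε : Bool) :
    (SimpleGraph.fromRel (oddRel P)).Adj x (x.root ε) := by
  cases x <;> simp_all [OddVertex.isBottom, oddRel, SimpleGraph.fromRel_adj, OddVertex.root]

theorem oddColour_of_isBottom {x : OddVertex P} (hx : x.isBottom = true) (s : ℕ) :
    oddColour P s x = bif x.sup then 0 else s := by
  cases x <;> simp_all [OddVertex.isBottom, OddVertex.sup, oddColour]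

variable (P)

/-- The bottom clique takes over the role of the centre. Each index has a bottom vertex of colour
`0` and one of colour `s`, so two descending paths can be routed to different colours and joined by
an edge of the clique. Pairs outside `P` use the path `w`, `u`, `w` with the colours `1`, `0`, `2`,
without `s`. -/
theorem oddColour_lowerColouring (s : ℕ) :
    LowerColouring P (SimpleGraph.fromRel (oddRel P)) (oddAtt P) 1 s (oddColour P s) := by
  have hroot : ∀ (x : OddVertex P) ε, oddColour P s (x.root ε) = bif ε then 0 else s := by
    intro x ε
    rw [oddColour_of_isBottom (x.isBottom_root ε), x.sup_root]
  have hroot' : ∀ (x : OddVertex P) ε, oddColour P s (x.root ε) < 1 ∨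
      oddColour P s (x.root ε) = s := by
    intro x ε
    rw [hroot]
    cases ε <;> simp
  have hlow : ∀ {x y : OddVertex P} {ε : Bool}, x.isBottom = true → x.sup ≠ ε →
      (SimpleGraph.fromRel (oddRel P)).Adj x (y.root ε) := by
    intro x y ε hx hε
    refine OddVertex.adj_of_isBottom hx (y.isBottom_root ε) ?_
    rintro rfl
    exact hε (y.sup_root ε)
  have hv : ∀ (i : V) ε ε', (SimpleGraph.fromRel (oddRel P)).Adj (.v1 i ε) (.v0 i ε') :=
    fun i ε ε' => OddVertex.adj_root rfl ε'
  refine ⟨?_, ?_, ?_, ?_, ?_⟩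
  · rintro (⟨i, ε⟩ | ⟨i, ε⟩ | ⟨i, ε⟩ | ⟨i, ε⟩) <;> cases ε <;> simp [oddColour]
  · intro hs x y hxy
    cases hx : x.isBottom with
    | true =>
      cases hy : y.isBottom with
      | true => exact ⟨[], OddVertex.adj_of_isBottom hx hy hxy, by simp, by simp⟩
      | false =>
        -- The root with the other superscript is certainly distinct from `x`, and hence adjacent to
        -- it.
        exact ⟨[y.root (!x.sup)], ⟨hlow hx (by simp), OddVertex.adj_root hy _⟩, by simp,
          by simpa using hroot' y _⟩
    | false =>
      cases hy : y.isBottom with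
      | true =>
        exact ⟨[x.root (!y.sup)], ⟨OddVertex.adj_root hx _, hlow hy (by simp)⟩, by simp,
          by simpa using hroot' x _⟩
      | false =>
        refine ⟨[x.root false, y.root true], ⟨OddVertex.adj_root hx _,
          hlow (x.isBottom_root _) (by simp [OddVertex.sup_root]), OddVertex.adj_root hy _⟩, ?_, ?_⟩
        · simp [hroot]
          omega
        · simp [hroot]
  · intro hs i y ε hε
    have h₁ : oddColour P s (.v1 i ε) = 1 + ε.toNat := rfl
    cases hy : y.isBottom with
    | true =>
      refine ⟨[.v1 i ε, (OddVertex.v1 i ε).root (!y.sup)], ⟨rfl, OddVertex.adj_root rfl _,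
        hlow hy (by simp)⟩, ?_, ?_⟩
      · have := hroot' (.v1 i ε) (!y.sup)
        simp only [List.map_cons, List.map_nil, List.nodup_cons, List.mem_singleton,
          List.not_mem_nil, not_false_iff, List.nodup_nil, and_true, h₁]
        omega
      · have := hroot' (.v1 i ε) (!y.sup)
        intro z hz
        simp only [List.mem_cons, List.not_mem_nil, or_false] at hz
        rcases hz with rfl | rfl
        · exact .inr (.inr h₁)
        · omega
    | false =>
      refine ⟨[.v1 i ε, .v0 i false, y.root true], ⟨rfl, hv i ε false,
        hlow rfl (by simp [OddVertex.sup]), OddVertex.adj_root hy _⟩, ?_, ?_⟩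
      · have h₂ : oddColour P s (.v0 i false) = s := rfl
        simp [hroot, h₁, h₂]
        omega
      · have h₂ : oddColour P s (.v0 i false) = s := rfl
        simp [hroot, h₁, h₂]
  · intro hs i j _
    refine ⟨[.v1 i false, .v0 i false, .v0 j true, .v1 j true], ⟨rfl, hv i false false,
      OddVertex.adj_of_isBottom rfl rfl (by simp), (hv j true true).symm, rfl⟩, ?_, ?_⟩
    · simp [oddColour]
      omega
    · simp [oddColour]
  · intro i j hi hj
    have hw : ∀ ε ε', (SimpleGraph.fromRel (oddRel P)).Adj (.w ⟨(i, j), hi, hj⟩ ε)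
      (.u ⟨(i, j), hi, hj⟩ ε') := fun ε ε' => OddVertex.adj_root rfl ε'
    refine ⟨[.w ⟨(i, j), hi, hj⟩ false, .u ⟨(i, j), hi, hj⟩ true, .w ⟨(i, j), hi, hj⟩ true],
      ⟨rfl, hw _ _, (hw _ _).symm, rfl⟩, ?_, ?_⟩
    · simp [oddColour]
    · simp [oddColour]

/-- The lower part of `G_(m + 2)` has a colouring that provides rainbow paths. -/
theorem exists_lowerColouring (s : ℕ) : ∀ m : ℕ, ∃ col : (lower P (m + 2)).carrier → ℕ,
    LowerColouring P (lower P (m + 2)).graph (lower P (m + 2)).att m s col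
  | 0 => ⟨_, evenColour_lowerColouring P s⟩
  | 1 => ⟨_, oddColour_lowerColouring P s⟩
  | m + 2 => by
    obtain ⟨col, h⟩ := exists_lowerColouring s m
    exact ⟨_, h.split (Lower.isSplit_split _)⟩

/-! ### The edges of `G_k` -/

variable (G : SimpleGraph V) (k : ℕ)

theorem layeredGraph_adj_inl_inl (x y : (lower P k).carrier) :
    (layeredGraph G P k).Adj (.inl x) (.inl y) ↔ (lower P k).graph.Adj x y := by
  simp only [layeredGraph, SimpleGraph.fromRel_adj, ne_eq, Sum.inl.injEq]
  constructor
  · rintro ⟨_, h | h⟩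
    exacts [h, h.symm]
  · exact fun h => ⟨h.ne, .inl h⟩

theorem layeredGraph_adj_inl_inr (x : (lower P k).carrier) (i : V) :
    (layeredGraph G P k).Adj (.inl x) (.inr i) ↔ (lower P k).att i x := by
  simp [layeredGraph, SimpleGraph.fromRel_adj]

theorem layeredGraph_adj_inr_inr (i j : V) :
    (layeredGraph G P k).Adj (.inr i) (.inr j) ↔ G.Adj i j := by
  simp only [layeredGraph, SimpleGraph.fromRel_adj, ne_eq, Sum.inr.injEq]
  constructor
  · rintro ⟨_, h | h⟩
    exacts [h, h.symm]
  · exact fun h => ⟨h.ne, .inl h⟩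

/-- The graph is an induced subgraph of `G_k`. -/
def topEmbedding : G ↪g layeredGraph G P k where
  toFun := Sum.inr
  inj' := Sum.inr_injective
  map_rel_iff' := layeredGraph_adj_inr_inr P G k _ _

section Threads

variable {P G k} {C : Type} {c : (lower P k).carrier ⊕ V → C} {l : List (lower P k).carrier}

theorem rainbowPair_inl_inl {x y : (lower P k).carrier}
    (h : Thread (lower P k).graph.Adj ((lower P k).graph.Adj y) ((lower P k).graph.Adj x)
      ((lower P k).graph.Adj x y) l) (hc : (l.map fun x => c (.inl x)).Nodup) :
    RainbowPair (layeredGraph G P k) c (.inl x) (.inl y) := by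
  have hadj : ∀ x y, (lower P k).graph.Adj x y → (layeredGraph G P k).Adj (.inl x) (.inl y) :=
    fun x y => (layeredGraph_adj_inl_inl P G k x y).2
  exact Thread.rainbowPair (h.map Sum.inl hadj (hadj y) (hadj x) (hadj x y))
    (by rwa [List.map_map])

theorem rainbowPair_inr_inl {i : V} {y : (lower P k).carrier}
    (h : Thread (lower P k).graph.Adj ((lower P k).graph.Adj y) ((lower P k).att i)
      ((lower P k).att i y) l) (hc : (l.map fun x => c (.inl x)).Nodup) :
    RainbowPair (layeredGraph G P k) c (.inr i) (.inl y) := by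
  have hadj : ∀ x y, (lower P k).graph.Adj x y → (layeredGraph G P k).Adj (.inl x) (.inl y) :=
    fun x y => (layeredGraph_adj_inl_inl P G k x y).2
  have hatt : ∀ i x, (lower P k).att i x → (layeredGraph G P k).Adj (.inr i) (.inl x) :=
    fun i x h => ((layeredGraph_adj_inl_inr P G k x i).2 h).symm
  exact Thread.rainbowPair (h.map Sum.inl hadj (hadj y) (hatt i) (hatt i y))
    (by rwa [List.map_map])

theorem rainbowPair_inr_inr {i j : V}
    (h : Thread (lower P k).graph.Adj ((lower P k).att j) ((lower P k).att i) False l)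
    (hc : (l.map fun x => c (.inl x)).Nodup) :
    RainbowPair (layeredGraph G P k) c (.inr i) (.inr j) := by
  have hadj : ∀ x y, (lower P k).graph.Adj x y → (layeredGraph G P k).Adj (.inl x) (.inl y) :=
    fun x y => (layeredGraph_adj_inl_inl P G k x y).2
  have hatt : ∀ i x, (lower P k).att i x → (layeredGraph G P k).Adj (.inr i) (.inl x) :=
    fun i x h => ((layeredGraph_adj_inl_inr P G k x i).2 h).symm
  exact Thread.rainbowPair (h.map Sum.inl hadj (hatt j) (hatt i) False.elim)
    (by rwa [List.map_map])

end Threads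

/-! ### The colouring of the whole of `G_k`, and its connectedness -/

theorem exists_rainbowConnected_layeredGraph {m : ℕ} {c : V → Fin (m + 2)}
    (hc : ∀ q ∈ P, RainbowPair G c q.1 q.2) :
    ∃ c' : (lower P (m + 2)).carrier ⊕ V → Fin (m + 2),
      RainbowConnected (layeredGraph G P (m + 2)) c' := by
  -- With `s = m + 1`, the last of the `m + 2` colours, no further colour is needed. The field `top`
  -- is then unavailable, but two top vertices are covered by `P` or by `nonPair`. The field `mixed`
  -- still applies with `ε = false`, as `s ≠ m`.
  obtain ⟨col, h⟩ := exists_lowerColouring P (m + 1) m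
  have hb : ∀ x, col x < m + 2 := fun x => (h.bound x).elim id fun h => by omega
  refine ⟨Sum.elim (fun x => ⟨col x, hb x⟩) c, ?_⟩
  have hnd : ∀ l : List (lower P (m + 2)).carrier, (l.map col).Nodup →
      (l.map fun x => (⟨col x, hb x⟩ : Fin (m + 2))).Nodup := by
    intro l hl
    refine List.Nodup.of_map Fin.val ?_
    rwa [List.map_map]
  have hmixed : ∀ i y, RainbowPair (layeredGraph G P (m + 2))
      (Sum.elim (fun x => ⟨col x, hb x⟩) c) (.inr i) (.inl y) := by
    intro i y
    obtain ⟨l, h₁, h₂, _⟩ := h.mixed (by omega) i y false (by simp)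
    exact rainbowPair_inr_inl h₁ (hnd l h₂)
  rintro (x | i) (y | j)
  · by_cases hxy : x = y
    · subst hxy
      exact RainbowPair.refl _ _ _
    · obtain ⟨l, h₁, h₂, _⟩ := h.lower (by omega) x y hxy
      exact rainbowPair_inl_inl h₁ (hnd l h₂)
  · exact (hmixed j x).symm
  · exact hmixed i y
  · have hP : ∀ i j, (i, j) ∈ P → RainbowPair (layeredGraph G P (m + 2))
        (Sum.elim (fun x => ⟨col x, hb x⟩) c) (.inr i) (.inr j) :=
      fun i j hij => (hc (i, j) hij).map (topEmbedding P G (m + 2)) fun _ => rfl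
    by_cases hi : (i, j) ∈ P
    · exact hP i j hi
    by_cases hj : (j, i) ∈ P
    · exact (hP j i hj).symm
    obtain ⟨l, h₁, h₂, _⟩ := h.nonPair i j hi hj
    exact rainbowPair_inr_inr h₁ (hnd l h₂)

theorem nonempty_lower (i : V) : ∀ m : ℕ, Nonempty (lower P (m + 2)).carrier
  | 0 => ⟨EvenVertex.u⟩
  | 1 => ⟨OddVertex.v0 i false⟩
  | _ + 2 => ⟨Sum.inr (i, false)⟩

/-- The paths from top vertices to lower vertices suffice, since there is at least one vertex of
each sort. -/
theorem connected_layeredGraph [Nonempty V] (m : ℕ) : (layeredGraph G P (m + 2)).Connected := by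
  obtain ⟨col, h⟩ := exists_lowerColouring P (m + 1) m
  have hmixed : ∀ i y, (layeredGraph G P (m + 2)).Reachable (.inr i) (.inl y) := by
    intro i y
    obtain ⟨l, h₁, h₂, _⟩ := h.mixed (by omega) i y false (by simp)
    obtain ⟨p, _⟩ := rainbowPair_inr_inl (G := G) (c := Sum.elim col fun _ => 0) h₁ h₂
    exact ⟨p⟩
  have hlower : ∀ x y, (layeredGraph G P (m + 2)).Reachable (.inl x) (.inl y) := by
    intro x y
    obtain ⟨i⟩ := ‹Nonempty V›
    exact (hmixed i x).symm.trans (hmixed i y)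
  have htop : ∀ i j, (layeredGraph G P (m + 2)).Reachable (.inr i) (.inr j) := by
    intro i j
    obtain ⟨x⟩ := nonempty_lower P i m
    exact (hmixed i x).trans (hmixed j x).symm
  refine ⟨?_⟩
  rintro (x | i) (y | j)
  · exact hlower x y
  · exact (hmixed j x).symm
  · exact hmixed i y
  · exact htop i j

end RVC

/-! ### Lower bounds for the length of paths that leave the top layer -/

namespace RVC

variable {V : Type} {P : Set (V × V)}

/-- The function `f` on the vertices of `G_k` below the top layer bounds from below the number of
steps in which they can be reached from the top vertex belonging to `a` through vertices below the
top layer. -/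
structure Potential {α : Type} (P : Set (V × V)) (G : SimpleGraph α) (att : V → α → Prop) (k : ℕ)
    (a : V) (f : α → ℕ) : Prop where
  lipschitz : ∀ x y, G.Adj x y → f y ≤ f x + 1
  le : ∀ x, f x ≤ k + 1
  near : ∀ x, att a x → f x ≤ 1
  far : ∀ b x, b ≠ a → att b x → k ≤ f x
  far_of_mem : ∀ b x, b ≠ a → att b x → (a, b) ∈ P ∨ (b, a) ∈ P → k + 1 ≤ f x

theorem lipschitz_fromRel {α : Type} {r : α → α → Prop} {f : α → ℕ}
    (h : ∀ x y, r x y → f y ≤ f x + 1 ∧ f x ≤ f y + 1) (x y : α)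
    (hxy : (SimpleGraph.fromRel r).Adj x y) : f y ≤ f x + 1 := by
  obtain ⟨_, h' | h'⟩ := (SimpleGraph.fromRel_adj ..).1 hxy
  exacts [(h _ _ h').1, (h _ _ h').2]

/-- The entry of a pair with the given superscript. -/
def NonPair.entry (p : NonPair P) (ε : Bool) : V := bif ε then p.1.2 else p.1.1

/-- The gadget of a pair outside `P` is the only short cut between two top vertices, and no gadget
joins the two entries of a pair in `P`. -/
theorem NonPair.entry_ne {p : NonPair P} {ε : Bool} {a b : V} (h : (a, b) ∈ P ∨ (b, a) ∈ P)
    (hb : b = p.entry ε) : p.entry (!ε) ≠ a := by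
  obtain ⟨⟨i, j⟩, hi, hj⟩ := p
  rintro rfl
  subst hb
  cases ε
  · exact h.elim hj hi
  · exact h.elim hi hj

theorem evenAtt_w {i : V} {p : NonPair P} {ε : Bool} :
    evenAtt P i (.w p ε) ↔ i = p.entry ε := by
  cases ε <;> rfl

theorem oddAtt_w {i : V} {p : NonPair P} {ε : Bool} :
    oddAtt P i (.w p ε) ↔ i = p.entry ε := by
  cases ε <;> rfl

open Classical in
/-- The number of steps from the top vertex belonging to `a` in `G_2`. -/
noncomputable def evenPotential (P : Set (V × V)) (a : V) : EvenVertex P → ℕ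
  | .u => 2
  | .v i _ => if i = a then 1 else 3
  | .w p ε => if p.entry ε = a then 1 else if p.entry (!ε) = a then 2 else 3

/-- Apart from the neighbours of `a`, only `u` and the partners in gadgets at `a` are reached in two
steps. Among these, `u` has no top neighbour, and a partner leads to some `b` only if `(a, b)` and
`(b, a)` are both outside `P`. -/
theorem potential_even (a : V) :
    Potential P (SimpleGraph.fromRel (evenRel P)) (evenAtt P) 2 a (evenPotential P a) where
  lipschitz := by
    refine lipschitz_fromRel ?_
    rintro (_ | ⟨i, ε⟩ | ⟨p, ε⟩) (_ | ⟨j, δ⟩ | ⟨q, δ⟩) h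
    all_goals simp only [evenRel] at h
    all_goals simp only [evenPotential]
    all_goals try subst h
    all_goals try cases ε
    all_goals try cases δ
    all_goals try split_ifs
    all_goals first | omega | (exfalso; tauto)
  le := by
    rintro (_ | ⟨i, ε⟩ | ⟨p, ε⟩) <;> simp only [evenPotential] <;> (try split_ifs) <;> omega
  near := by
    rintro (_ | ⟨i, ε⟩ | ⟨p, ε⟩) h
    · exact h.elim
    · rw [evenPotential, if_pos (Eq.symm h)]
    · rw [evenPotential, if_pos (evenAtt_w.1 h).symm]
  far := by
    rintro b (_ | ⟨i, ε⟩ | ⟨p, ε⟩) hb h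
    · exact h.elim
    · rw [evenPotential, if_neg fun h' => hb (Eq.trans h h')]
      omega
    · rw [evenPotential, if_neg fun h' => hb ((evenAtt_w.1 h).trans h')]
      split_ifs <;> omega
  far_of_mem := by
    rintro b (_ | ⟨i, ε⟩ | ⟨p, ε⟩) hb h hP
    · exact h.elim
    · rw [evenPotential, if_neg fun h' => hb (Eq.trans h h')]
    · rw [evenPotential, if_neg fun h' => hb ((evenAtt_w.1 h).trans h'),
        if_neg (NonPair.entry_ne hP (evenAtt_w.1 h))]

open Classical in
/-- The number of steps from the top vertex belonging to `a` in `G_3`. -/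
noncomputable def oddPotential (P : Set (V × V)) (a : V) : OddVertex P → ℕ
  | .v0 i _ => if i = a then 2 else 3
  | .u p _ => if p.entry false = a ∨ p.entry true = a then 2 else 3
  | .v1 i _ => if i = a then 1 else 4
  | .w p ε => if p.entry ε = a then 1 else if p.entry (!ε) = a then 3 else 4

/-- In a gadget at `a`, the bottom vertices `u` lie at `2` and the partner at `3`. Any other route
has to cross the bottom clique and arrives below another top vertex with the value `4`. -/
theorem potential_odd (a : V) :
    Potential P (SimpleGraph.fromRel (oddRel P)) (oddAtt P) 3 a (oddPotential P a) where
  lipschitz := by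
    refine lipschitz_fromRel ?_
    rintro (⟨i, ε⟩ | ⟨p, ε⟩ | ⟨i, ε⟩ | ⟨p, ε⟩) (⟨j, δ⟩ | ⟨q, δ⟩ | ⟨j, δ⟩ | ⟨q, δ⟩) h
    all_goals simp only [oddRel] at h
    all_goals simp only [oddPotential]
    all_goals try subst h
    all_goals try cases δ
    all_goals split_ifs <;> first | omega | (exfalso; tauto)
  le := by
    rintro (⟨i, ε⟩ | ⟨p, ε⟩ | ⟨i, ε⟩ | ⟨p, ε⟩) <;> simp only [oddPotential] <;> split_ifs <;> omega
  near := by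
    rintro (⟨i, ε⟩ | ⟨p, ε⟩ | ⟨i, ε⟩ | ⟨p, ε⟩) h
    · exact h.elim
    · exact h.elim
    · rw [oddPotential, if_pos (Eq.symm h)]
    · rw [oddPotential, if_pos (oddAtt_w.1 h).symm]
  far := by
    rintro b (⟨i, ε⟩ | ⟨p, ε⟩ | ⟨i, ε⟩ | ⟨p, ε⟩) hb h
    · exact h.elim
    · exact h.elim
    · rw [oddPotential, if_neg fun h' => hb (Eq.trans h h')]
      omega
    · rw [oddPotential, if_neg fun h' => hb ((oddAtt_w.1 h).trans h')]
      split_ifs <;> omega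
  far_of_mem := by
    rintro b (⟨i, ε⟩ | ⟨p, ε⟩ | ⟨i, ε⟩ | ⟨p, ε⟩) hb h hP
    · exact h.elim
    · exact h.elim
    · rw [oddPotential, if_neg fun h' => hb (Eq.trans h h')]
    · rw [oddPotential, if_neg fun h' => hb ((oddAtt_w.1 h).trans h'),
        if_neg (NonPair.entry_ne hP (oddAtt_w.1 h))]

-- A new layer adds one step before the old lower part is entered and one after it is left. The new
-- values are only bounds: they are capped at `k + 3`, and the dependence on `P` is built into the
-- values at the split vertices.
open Classical in
theorem Potential.split {α : Type} {G : SimpleGraph α} {att : V → α → Prop} {k : ℕ} {a : V}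
    {f : α → ℕ} (h : Potential P G att k a f) {H : SimpleGraph (α ⊕ V × Bool)}
    {att' : V → α ⊕ V × Bool → Prop} (hH : IsSplit G att H att') :
    Potential P H att' (k + 2) a (Sum.elim (fun x => f x + 1) fun q =>
      if q.1 = a then 1 else if (a, q.1) ∈ P ∨ (q.1, a) ∈ P then k + 3 else k + 2) := by
  -- The fields `near`, `far` and `far_of_mem` were made to control the edges to the split vertices
  -- from one side, and the cap `le` from the other.
  have hmixed : ∀ x q, H.Adj (.inl x) (.inr q) →
      (if q.1 = a then 1 else if (a, q.1) ∈ P ∨ (q.1, a) ∈ P then k + 3 else k + 2) ≤ f x + 2 ∧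
      f x ≤ if q.1 = a then 1 else if (a, q.1) ∈ P ∨ (q.1, a) ∈ P then k + 3 else k + 2 := by
    intro x q hxq
    have hx := (hH.inl_inr x q).1 hxq
    have hle := h.le x
    split_ifs with h₁ h₂
    · rw [h₁] at hx
      have := h.near x hx
      omega
    · have := h.far_of_mem q.1 x h₁ hx h₂
      omega
    · have := h.far q.1 x h₁ hx
      omega
  refine ⟨?_, ?_, ?_, ?_, ?_⟩
  · rintro (x | q) (y | q') hxy <;> simp only [Sum.elim_inl, Sum.elim_inr]
    · have := h.lipschitz x y ((hH.inl_inl x y).1 hxy)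
      omega
    · have := (hmixed x q' hxy).1
      omega
    · have := (hmixed y q hxy.symm).2
      omega
    · rw [((hH.inr_inr q q').1 hxy).2]
      omega
  · rintro (x | q) <;> simp only [Sum.elim_inl, Sum.elim_inr]
    · have := h.le x
      omega
    · split_ifs <;> omega
  · rintro (x | q) hx
    · exact absurd hx (hH.att_inl a x)
    · rw [Sum.elim_inr, if_pos ((hH.att_inr a q).1 hx).symm]
  · rintro b (x | q) hb hx
    · exact absurd hx (hH.att_inl b x)
    · obtain rfl := (hH.att_inr b q).1 hx
      rw [Sum.elim_inr, if_neg hb]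
      split_ifs <;> omega
  · rintro b (x | q) hb hx hP
    · exact absurd hx (hH.att_inl b x)
    · obtain rfl := (hH.att_inr b q).1 hx
      rw [Sum.elim_inr, if_neg hb, if_pos hP]

theorem exists_potential (P : Set (V × V)) (a : V) : ∀ m : ℕ, ∃ f,
    Potential P (lower P (m + 2)).graph (lower P (m + 2)).att (m + 2) a f
  | 0 => ⟨_, potential_even a⟩
  | 1 => ⟨_, potential_odd a⟩
  | m + 2 => by
    obtain ⟨f, h⟩ := exists_potential P a m
    exact ⟨_, h.split (Lower.isSplit_split _)⟩

variable {G : SimpleGraph V}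

/-- The first vertex of the top layer on a walk that starts below it. -/
theorem exists_inr_of_walk {k : ℕ} {f : (lower P k).carrier → ℕ}
    (hf : ∀ x y, (lower P k).graph.Adj x y → f y ≤ f x + 1) {j : V} :
    ∀ {x : (lower P k).carrier} (p : (layeredGraph G P k).Walk (.inl x) (.inr j)),
      ∃ b y, ∃ q : (layeredGraph G P k).Walk (.inr b) (.inr j), (lower P k).att b y ∧
        q.support ⊆ p.support ∧ f y + 1 + q.length ≤ f x + p.length
  | x, .cons (v := .inl y) h p => by
    obtain ⟨b, z, q, h₁, h₂, h₃⟩ := exists_inr_of_walk hf p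
    have := hf x y ((layeredGraph_adj_inl_inl P G k x y).1 h)
    refine ⟨b, z, q, h₁, fun v hv => List.mem_cons_of_mem _ (h₂ hv), ?_⟩
    rw [SimpleGraph.Walk.length_cons]
    omega
  | x, .cons (v := .inr b) h p => by
    refine ⟨b, x, p, (layeredGraph_adj_inl_inr P G k x b).1 h,
      fun v hv => List.mem_cons_of_mem _ hv, ?_⟩
    rw [SimpleGraph.Walk.length_cons]
    omega

/-- The walk first returns to the top at some `b`, from a vertex with potential at least `m + 2`,
while it started at potential at most `1`. -/
theorem le_length_of_adj_inl {m : ℕ} {a j : V} {x : (lower P (m + 2)).carrier}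
    (h : (layeredGraph G P (m + 2)).Adj (.inr a) (.inl x))
    (p : (layeredGraph G P (m + 2)).Walk (.inl x) (.inr j)) (hp : (p.cons h).IsPath) :
    m + 2 ≤ p.length ∧ ((a, j) ∈ P ∨ (j, a) ∈ P → m + 3 ≤ p.length) := by
  obtain ⟨f, hf⟩ := exists_potential P a m
  obtain ⟨b, y, q, h₁, h₂, h₃⟩ := exists_inr_of_walk hf.lipschitz p
  have hx := hf.near x ((layeredGraph_adj_inl_inr P G _ x a).1 h.symm)
  -- A path does not return to its start.
  have hb : b ≠ a := by
    rintro rfl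
    exact ((SimpleGraph.Walk.cons_isPath_iff ..).1 hp).2 (h₂ q.start_mem_support)
  have hy := hf.far b y hb h₁
  refine ⟨by omega, fun hP => ?_⟩
  -- If the first return is at `j`, then the pair in `P` forces one more step below the top;
  -- otherwise, at least one more step follows the return.
  rcases Nat.eq_zero_or_pos q.length with hq | hq
  · obtain rfl : b = j := Sum.inr_injective (SimpleGraph.Walk.eq_of_length_eq_zero hq)
    have := hf.far_of_mem b y hb h₁ hP
    omega
  · omega

/-- Short paths between vertices of the top layer stay there. -/
theorem exists_walk_of_length_le {m : ℕ} {j : V} : ∀ {a : V}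
    (p : (layeredGraph G P (m + 2)).Walk (.inr a) (.inr j)), p.IsPath → p.length ≤ m + 2 →
      ∃ q : G.Walk a j, q.support.map Sum.inr = p.support
  | _, .nil, _, _ => ⟨.nil, rfl⟩
  | a, .cons (v := .inr b) h p, hp, hl => by
    rw [SimpleGraph.Walk.length_cons] at hl
    obtain ⟨q, hq⟩ := exists_walk_of_length_le p hp.of_cons (by omega)
    refine ⟨.cons ((layeredGraph_adj_inr_inr P G _ a b).1 h) q, ?_⟩
    rw [SimpleGraph.Walk.support_cons, SimpleGraph.Walk.support_cons, List.map_cons, hq]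
  | _, .cons (v := .inl x) h p, hp, hl => by
    have := (le_length_of_adj_inl h p hp).1
    rw [SimpleGraph.Walk.length_cons] at hl
    omega

/-- Membership in `P` is needed only if the very first step goes down. After a first step within the
top layer, the rest is short enough for `exists_walk_of_length_le`, which makes no assumption on its
ends. -/
theorem exists_walk_of_mem {m : ℕ} {a j : V} (hP : (a, j) ∈ P) :
    ∀ p : (layeredGraph G P (m + 2)).Walk (.inr a) (.inr j), p.IsPath → p.length ≤ m + 3 →
      ∃ q : G.Walk a j, q.support.map Sum.inr = p.support
  | .nil, _, _ => ⟨.nil, rfl⟩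
  | .cons (v := .inr b) h p, hp, hl => by
    rw [SimpleGraph.Walk.length_cons] at hl
    obtain ⟨q, hq⟩ := exists_walk_of_length_le p hp.of_cons (by omega)
    refine ⟨.cons ((layeredGraph_adj_inr_inr P G _ a b).1 h) q, ?_⟩
    rw [SimpleGraph.Walk.support_cons, SimpleGraph.Walk.support_cons, List.map_cons, hq]
  | .cons (v := .inl x) h p, hp, hl => by
    have := (le_length_of_adj_inl h p hp).2 (.inl hP)
    rw [SimpleGraph.Walk.length_cons] at hl
    omega

theorem rainbowPair_of_layeredGraph {m : ℕ} {c : (lower P (m + 2)).carrier ⊕ V → Fin (m + 2)}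
    {a b : V} (hP : (a, b) ∈ P) (h : RainbowPair (layeredGraph G P (m + 2)) c (.inr a) (.inr b)) :
    RainbowPair G (fun i => c (.inr i)) a b := by
  obtain ⟨p, hp, hc⟩ := h
  -- There are `m + 2` colours, and the number of internal vertices is `p.length - 1`.
  have hl : p.length ≤ m + 3 := by
    have := hc.length_le_card
    simp only [List.length_map, List.length_dropLast, List.length_tail,
      SimpleGraph.Walk.length_support, Fintype.card_fin] at this
    omega
  obtain ⟨q, hq⟩ := exists_walk_of_mem hP p hp hl
  refine ⟨q, ?_, ?_⟩
  · rw [SimpleGraph.Walk.isPath_def] at hp ⊢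
    rw [← hq] at hp
    exact hp.of_map _
  · rwa [← hq, ← List.map_tail, ← List.map_dropLast, List.map_map] at hc

end RVC

namespace RVC

/-! ### Colourings with `k` colours -/

theorem RainbowPair.comp {V C D : Type} {G : SimpleGraph V} {c : V → C} {a b : V} {g : C → D}
    (hg : Function.Injective g) (h : RainbowPair G c a b) :
    RainbowPair G (fun x => g (c x)) a b := by
  obtain ⟨p, hp, hc⟩ := h
  refine ⟨p, hp, ?_⟩
  have := hc.map hg
  rwa [List.map_map] at this

theorem RainbowConnected.map {V W C : Type} {G : SimpleGraph V} {H : SimpleGraph W} (e : G ≃g H)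
    {c : V → C} (h : RainbowConnected G c) : RainbowConnected H fun x => c (e.symm x) := by
  intro a b
  have := (h (e.symm a) (e.symm b)).map (c' := fun x => c (e.symm x)) e.toEmbedding fun x => by
    simp
  simpa using this

theorem rainbowConnected_top {V C : Type} (c : V → C) :
    RainbowConnected (⊤ : SimpleGraph V) c := by
  intro a b
  by_cases hab : a = b
  · subst hab
    exact RainbowPair.refl _ _ _
  · exact Thread.rainbowPair (l := []) hab List.nodup_nil

/-- In a complete graph any colouring works, and one exists as `k > 0`; this reconciles the special
value `0` with colourings. Otherwise a colouring with fewer colours is also one with `k`. -/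
theorem rvc_le_iff {V : Type} (G : SimpleGraph V) {k : ℕ} (hk : 0 < k) :
    rvc G ≤ k ↔ ∃ c : V → Fin k, RainbowConnected G c := by
  unfold rvc
  split_ifs with hG
  · subst hG
    exact ⟨fun _ => ⟨fun _ => ⟨0, hk⟩, rainbowConnected_top _⟩, fun _ => zero_le⟩
  · constructor
    · intro h
      -- A strict upper bound on the infimum yields a witness, so `≤ k` is replaced by `< k + 1`.
      have h' : (⨅ (m : ℕ) (_ : ∃ c : V → Fin m, RainbowConnected G c), (m : ℕ∞)) <
          ((k + 1 : ℕ) : ℕ∞) := lt_of_le_of_lt h (by exact_mod_cast Nat.lt_succ_self k)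
      obtain ⟨m, hm⟩ := iInf_lt_iff.1 h'
      obtain ⟨⟨c, hc⟩, hm⟩ := iInf_lt_iff.1 hm
      have hmk : m ≤ k := Nat.lt_succ_iff.1 (by exact_mod_cast hm)
      exact ⟨_, fun a b => (hc a b).comp (Fin.castLE_injective hmk)⟩
    · exact fun h => iInf₂_le k h

theorem exists_rainbowConnected_layeredGraph_iff {V : Type} (P : Set (V × V)) (G : SimpleGraph V)
    {k : ℕ} (hk : 2 ≤ k) :
    (∃ c : (lower P k).carrier ⊕ V → Fin k, RainbowConnected (layeredGraph G P k) c) ↔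
      ∃ c : V → Fin k, ∀ q ∈ P, RainbowPair G c q.1 q.2 := by
  obtain ⟨m, rfl⟩ := Nat.exists_eq_add_of_le' hk
  constructor
  · rintro ⟨c, hc⟩
    exact ⟨_, fun q hq => rainbowPair_of_layeredGraph hq (hc _ _)⟩
  · rintro ⟨c, hc⟩
    exact exists_rainbowConnected_layeredGraph P G hc

theorem isPolyTimeReduction_allPairs {k : ℕ} (hk : 2 ≤ k) :
    IsPolyTimeReduction encodeGraph encodePairs (RvcAtMost k) (SubsetRainbow k)
      fun x => ⟨x.order, x.graph, Set.univ⟩ := by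
  refine ⟨polyTimeComputable_allPairs, fun x => (rvc_le_iff x.graph (by omega)).trans ?_⟩
  exact exists_congr fun c => ⟨fun h q _ => h q.1 q.2, fun h a b => h (a, b) trivial⟩

theorem subsetRainbow_iff_rvcAtMost {k : ℕ} (hk : 2 ≤ k) {x : PairInstance} {y : GraphInstance}
    (e : y.graph ≃g layeredGraph x.graph x.pairs k) : SubsetRainbow k x ↔ RvcAtMost k y := by
  refine Iff.trans ?_ (rvc_le_iff y.graph (by omega)).symm
  refine (exists_rainbowConnected_layeredGraph_iff x.pairs x.graph hk).symm.trans ?_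
  exact ⟨fun ⟨_, h⟩ => ⟨_, h.map e.symm⟩, fun ⟨_, h⟩ => ⟨_, h.map e⟩⟩

end RVC

theorem lemma2 (k : ℕ) (hk : 2 ≤ k) :
    RVC.PolyTimeEquivalent RVC.encodeGraph RVC.encodePairs (RVC.RvcAtMost k) (RVC.SubsetRainbow k) ∧
    ∃ f : RVC.PairInstance → RVC.GraphInstance,
      RVC.IsPolyTimeReduction RVC.encodePairs RVC.encodeGraph
        (RVC.SubsetRainbow k) (RVC.RvcAtMost k) f ∧
      ∀ x : RVC.PairInstance,
        Nonempty ((f x).graph ≃g RVC.layeredGraph x.graph x.pairs k) ∧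
        (∃ φ : x.graph ↪g RVC.layeredGraph x.graph x.pairs k, ∀ i, φ i = Sum.inr i) ∧
        (0 < x.order → (f x).graph.Connected) := by
  obtain ⟨f, hf, hiso⟩ := RVC.exists_polyTimeComputable_layeredGraph k
  have hred : RVC.IsPolyTimeReduction RVC.encodePairs RVC.encodeGraph (RVC.SubsetRainbow k)
      (RVC.RvcAtMost k) f := by
    refine ⟨hf, fun x => ?_⟩
    obtain ⟨e⟩ := hiso x
    exact RVC.subsetRainbow_iff_rvcAtMost hk e
  refine ⟨⟨⟨_, RVC.isPolyTimeReduction_allPairs hk⟩, f, hred⟩, f, hred, fun x => ⟨hiso x,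
    ⟨RVC.topEmbedding x.pairs x.graph k, fun _ => rfl⟩, fun hx => ?_⟩⟩
  obtain ⟨e⟩ := hiso x
  obtain ⟨m, rfl⟩ := Nat.exists_eq_add_of_le' hk
  have : Nonempty (Fin x.order) := ⟨⟨0, hx⟩⟩
  exact e.connected_iff.2 (RVC.connected_layeredGraph x.pairs x.graph m)
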